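/- Let $\mathbb K$ be a field, let $V$ be an $n$-dimensional vector space over $\mathbb K$ with a complete flag $V_1\subset V_2\subset\dots\subset V_n=V$, and let $B\subset \mathrm{GL}(V)$ be the stabilizer of the flag (a Borel subgroup). Let $U,W\subset V$ be subspaces with $\dim U=k$, $\dim W=l$, regarded as a point of $X=\mathrm{Gr}(k,V)\times\mathrm{Gr}(l,V)$. There exist a basis $(v_1,\dots,v_n)$ of $V$ with $V_i=\langle v_1,\dots,v_i\rangle$ for all $i$, subsets $\bar\alpha,\bar\beta,\bar\gamma\subset\{1,\dots,n\}$, and an involution $\sigma\in S_n$ such that: $\bar\gamma\subset\bar\alpha$; $\bar\beta\cap\bar\gamma=\varnothing$; $\sigma(c)<c$ and $\sigma(c)\notin\bar\alpha\cup\bar\beta$ for each $c\in\bar\gamma$; $\sigma$ is the product of the disjoint transpositions $(c,\sigma(c))$, $c\in\bar\gamma$; the vectors $v_a$ $(a\in\bar\alpha)$ form a basis of $U$; and the vectors $v_b$ $(b\in\bar\beta)$ together with $v_c+v_{\sigma(c)}$ $(c\in\bar\gamma)$ form a basis of $W$. For any such data, let $Y_1$ be the Young diagram in the $k\times(n-k)$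 rectangle bounded from below by the lattice path from the bottom-left to the top-right corner whose $j$th step is vertical if $j\in\bar\alpha$ and horizontal otherwise, and let $Y_2$ be the Young diagram in the $l\times(n-l)$ rectangle bounded in the same way by the path whose $j$th step is vertical if $j\in\bar\beta\cup\bar\gamma$ and horizontal otherwise. Let $(i,j)$ denote the box above the (horizontal) step $i$ and to the left of the (vertical) step $j$. The common diagram $Y_{com}$ consists of the boxes lying in columns above the steps that are horizontal in both paths and in rows to the left of the steps that are vertical in both paths, that is, of the boxes $(i,j)$, $i<j$, with $i\notin\bar\alpha\cup\bar\beta\cup\bar\gamma$ and $j\in\bar\alpha\cap(\bar\beta\cup\bar\gamma)$. The marked boxes are $(\sigma(c),c)$, $c\in\bar\gamma$; they lie in $Y_{com}$. The inward hook of a box of $Y_{com}$ consists of this box, all the boxes of $Y_{com}$ in the same column above it, and all the boxes of $Y_{com}$ in the same row to the left of it. Let $H$ be the union of the inward hooks of all marked boxes. Then the dimension of the $B$-orbit of $(U,W)$ in $X$ is $$\dim B(U,W)=\#Y_1+\#Y_2-\#Y_{com}+\#H,$$ where $\#$ denotes the number of boxes. Here, for a ground field that is not algebraically closed, the dimension of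 the orbit is understood geometrically, that is, as the Krull dimension in the Zariski topology of the orbit of the configuration obtained by extending scalars to an algebraically closed field $L\supseteq\mathbb K$ (any such $L$ gives the same number). -/

import Mathlib

open scoped TensorProduct

noncomputable section

namespace DoubleGr

/-! ### Flags, Borel subgroups, adapted bases -/

section Linear

variable {K V : Type*} [Field K] [AddCommGroup V] [Module K V]

/-- `F 0 ⊂ F 1 ⊂ … ⊂ F n = V` is a complete flag of subspaces, with `dim F i = i`. -/
structure IsCompleteFlag {n : ℕ} (F : Fin (n + 1) → Submodule K V) : Prop where
  mono : Monotone F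
  finrank_eq : ∀ i, Module.finrank K (F i) = (i : ℕ)
  top_eq : F (Fin.last n) = ⊤

/-- The subgroup of `GL(V)` that stabilizes every member of a family of subspaces.
For a complete flag this is the Borel subgroup attached to the flag. -/
def borel {n : ℕ} (F : Fin (n + 1) → Submodule K V) : Subgroup (V ≃ₗ[K] V) where
  carrier := {g | ∀ i, (F i).map (g : V →ₗ[K] V) = F i}
  one_mem' := fun i => Submodule.map_id (F i)
  mul_mem' := by
    intro a b ha hb i
    have h : ((a * b : V ≃ₗ[K] V) : V →ₗ[K] V) = (a : V →ₗ[K] V) ∘ₗ (b : V →ₗ[K] V) := rfl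
    rw [h, Submodule.map_comp, hb i, ha i]
  inv_mem' := by
    intro a ha i
    have h : ((a⁻¹ : V ≃ₗ[K] V) : V →ₗ[K] V) ∘ₗ (a : V →ₗ[K] V) = LinearMap.id := by
      ext x
      exact a.symm_apply_apply x
    conv_lhs => rw [← ha i]
    rw [← Submodule.map_comp, h, Submodule.map_id]

/-- The combinatorial data of a configuration: subsets `α`, `β`, `γ` of `{1, …, n}`
(here `Fin n`) and an involution `σ`, the product of the disjoint transpositions
`(c, σ c)`, `c ∈ γ`, with `σ c < c`.  The set of all `δ`'s is `σ(γ)`. -/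
structure CombData (n : ℕ) where
  α : Finset (Fin n)
  β : Finset (Fin n)
  γ : Finset (Fin n)
  σ : Equiv.Perm (Fin n)
  γ_subset_α : γ ⊆ α
  disjoint_β_γ : Disjoint β γ
  σ_lt : ∀ c ∈ γ, σ c < c
  σ_notMem_α : ∀ c ∈ γ, σ c ∉ α
  σ_notMem_β : ∀ c ∈ γ, σ c ∉ β
  σ_σ : ∀ c ∈ γ, σ (σ c) = c
  σ_fix : ∀ i, i ∉ γ → (∀ c ∈ γ, σ c ≠ i) → σ i = i

/-- `D` is the combinatorial data of the configuration `(U, W)` with respect to the flag `F`: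
there is a basis `v` of `V` adapted to the flag such that `U` has the basis `v a`, `a ∈ α`, and
`W` has the basis consisting of `v b`, `b ∈ β`, and of `v c + v (σ c)`, `c ∈ γ`.  (These families
are automatically linearly independent.) -/
def CombData.IsDataOf {n : ℕ} (D : CombData n) (F : Fin (n + 1) → Submodule K V)
    (U W : Submodule K V) : Prop :=
  ∃ v : Module.Basis (Fin n) K V,
    (∀ i, F i = v.flag i) ∧
    U = Submodule.span K {x | ∃ a ∈ D.α, x = v a} ∧
    W = Submodule.span K ({x | ∃ b ∈ D.β, x = v b} ∪ {x | ∃ c ∈ D.γ, x = v c + v (D.σ c)})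

end Linear

/-! ### Marked pairs of Young diagrams

A subset `S` of `Fin n` with `k` elements encodes a lattice path from the bottom-left to the
top-right corner of a `k × (n - k)` rectangle: the `j`-th step is vertical if `j ∈ S` and
horizontal otherwise.  The path bounds from below a Young diagram.  Each box of it lies
above exactly one horizontal step `i` and to the left of exactly one vertical step `j`, and is
denoted by `(i, j)`; so `i` names its column and `j` its row.  The box above the horizontal
step `i` and to the left of the vertical step `j` belongs to the diagram exactly when `i < j`.
Columns further to the left have smaller `i`; rows further up have larger `j`. -/

section Diagrams

variable {n : ℕ}

/-- The boxes of the Young diagram bounded by the path with set of vertical steps `S`. -/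
def diagram (S : Finset (Fin n)) : Finset (Fin n × Fin n) :=
  Finset.univ.filter fun p => p.1 ∉ S ∧ p.2 ∈ S ∧ p.1 < p.2

/-- The common diagram of the diagrams of `S` and `T`: the boxes in the columns above
the simultaneously horizontal steps and in the rows to the left of the simultaneously
vertical steps. -/
def commonDiagram (S T : Finset (Fin n)) : Finset (Fin n × Fin n) :=
  Finset.univ.filter fun p => (p.1 ∉ S ∧ p.1 ∉ T) ∧ (p.2 ∈ S ∧ p.2 ∈ T) ∧ p.1 < p.2

theorem commonDiagram_subset_left (S T : Finset (Fin n)) :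
    commonDiagram S T ⊆ diagram S := by
  intro p hp
  simp only [commonDiagram, diagram, Finset.mem_filter, Finset.mem_univ, true_and] at hp ⊢
  exact ⟨hp.1.1, hp.2.1.1, hp.2.2⟩

/-- The inward hook in the diagram `Y` with vertex `p`: the box `p`, the boxes of `Y` in the same
column above it, and the boxes of `Y` in the same row to the left of it. -/
def inwardHook (Y : Finset (Fin n × Fin n)) (p : Fin n × Fin n) : Finset (Fin n × Fin n) :=
  Y.filter fun q => q = p ∨ (q.1 = p.1 ∧ p.2 < q.2) ∨ (q.2 = p.2 ∧ q.1 < p.1)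

namespace CombData

variable (D : CombData n)

/-- The first Young diagram. -/
def Y₁ : Finset (Fin n × Fin n) := diagram D.α

/-- The second Young diagram. -/
def Y₂ : Finset (Fin n × Fin n) := diagram (D.β ∪ D.γ)

/-- The common diagram of the pair. -/
def Ycom : Finset (Fin n × Fin n) := commonDiagram D.α (D.β ∪ D.γ)

/-- The boxes with dots: above the step `σ c` and to the left of the step `c`, for `c ∈ γ`. -/
def dots : Finset (Fin n × Fin n) := D.γ.image fun c => (D.σ c, c)

/-- The dots lie in the common diagram. -/
theorem dots_subset_Ycom : D.dots ⊆ D.Ycom := by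
  intro p hp
  simp only [dots, Finset.mem_image] at hp
  obtain ⟨c, hc, rfl⟩ := hp
  simp only [Ycom, commonDiagram, Finset.mem_filter, Finset.mem_univ, true_and, Finset.mem_union,
    not_or]
  refine ⟨⟨D.σ_notMem_α c hc, D.σ_notMem_β c hc, fun h => ?_⟩,
    ⟨D.γ_subset_α hc, Or.inr hc⟩, D.σ_lt c hc⟩
  exact D.σ_notMem_α c hc (D.γ_subset_α h)

/-- The union of the inward hooks of the common diagram with vertices in the boxes with dots. -/
def H : Finset (Fin n × Fin n) := D.dots.biUnion (inwardHook D.Ycom)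

end CombData

end Diagrams

/-! ### The double Grassmannian as a Zariski topological space, and orbits in it -/

section Zariski

variable (L : Type*) [Field L]

/-- The algebra of polynomial functions on an `L`-vector space `E`: the algebra of functions
generated by the linear functionals. -/
def polyFun (E : Type*) [AddCommGroup E] [Module L E] : Subalgebra L (E → L) :=
  Algebra.adjoin L (Set.range fun φ : Module.Dual L E => (φ : E → L))

/-- The Zariski topology of a vector space, generated by the nonvanishing loci of polynomial
functions. -/
@[reducible] def zariski (E : Type*) [AddCommGroup E] [Module L E] : TopologicalSpace E :=
  TopologicalSpace.generateFrom {s | ∃ f ∈ polyFun L E, s = {x | f x ≠ 0}}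

variable (E : Type*) [AddCommGroup E] [Module L E] (k l : ℕ)

/-- Pairs consisting of a linearly independent `k`-tuple and a linearly independent `l`-tuple
of vectors of `E`. -/
def Frames : Type _ :=
  {p : (Fin k → E) × (Fin l → E) // LinearIndependent L p.1 ∧ LinearIndependent L p.2}

instance : TopologicalSpace (Frames L E k l) :=
  TopologicalSpace.induced Subtype.val (zariski L ((Fin k → E) × (Fin l → E)))

/-- The set of points of `Gr(k, E) × Gr(l, E)`: pairs of subspaces of dimensions `k` and `l`. -/
def DoubleGrassmannian : Type _ :=
  {P : Submodule L E × Submodule L E // Module.finrank L P.1 = k ∧ Module.finrank L P.2 = l}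

/-- The pair of subspaces spanned by a pair of frames. -/
def Frames.toGr (p : Frames L E k l) : DoubleGrassmannian L E k l :=
  ⟨(Submodule.span L (Set.range p.1.1), Submodule.span L (Set.range p.1.2)),
    by simpa using finrank_span_eq_card p.2.1, by simpa using finrank_span_eq_card p.2.2⟩

/-- The Zariski topology of the variety `Gr(k, E) × Gr(l, E)`, as the geometric quotient of
the variety of pairs of frames by `GL_k × GL_l`: a set is open iff its preimage in the
variety of pairs of frames is open. -/
instance : TopologicalSpace (DoubleGrassmannian L E k l) :=
  TopologicalSpace.coinduced (Frames.toGr L E k l) inferInstance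

variable {L E}

/-- The orbit of the configuration `(U, W)` under the subgroup `B` of `GL(E)`, as a subset of
`Gr(k, E) × Gr(l, E)`. -/
def orbit (B : Subgroup (E ≃ₗ[L] E)) (U W : Submodule L E) : Set (DoubleGrassmannian L E k l) :=
  {P | ∃ g ∈ B, P.1 = (U.map (g : E →ₗ[L] E), W.map (g : E →ₗ[L] E))}

end Zariski

/-- The dimension of the `B`-orbit of a configuration `(U, W)` of subspaces of `V`, where `B` is
the Borel subgroup of a flag `F`, computed over an algebraically closed extension `L` of
the ground field `K`: the Krull dimension, in the Zariski topology, of the orbit of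
the configuration `(L ⊗ U, L ⊗ W)` under the Borel subgroup of the flag `L ⊗ F` in `GL(L ⊗ V)`. -/
def orbitDim {K V : Type*} [Field K] [AddCommGroup V] [Module K V]
    (L : Type*) [Field L] [Algebra K L] {n : ℕ} (k l : ℕ)
    (F : Fin (n + 1) → Submodule K V) (U W : Submodule K V) : WithBot ℕ∞ :=
  topologicalKrullDim
    (orbit (L := L) (E := L ⊗[K] V) k l (borel fun i => (F i).baseChange L)
      (U.baseChange L) (W.baseChange L))

end DoubleGr

end

/-! After extension of scalars, `B` is the unit group of an associative algebra `b` of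
endomorphisms, and the elements of `b` preserving `U` and `W` form a linear subspace `A`. Hence the
orbit has dimension `dim b - dim A`, and this can be shown by linear algebra alone. Choose a
complement `C` of `A` in `b`. For `g ∈ B` the elements of `b` carrying `(U, W)` into `g(U, W)` form
`gA`; when `gA` still meets `C` trivially, `gA ⊕ C = b` by dimension, so `gA` contains exactly one
element `1 + c` with `c ∈ C`. Cramer's rule makes `c` a rational function of a frame of `g(U, W)`
(`exists_orbit_coordinate`). So `x ↦ (1 + x)(U, W)` embeds a nonempty open part of `C` as an open
part of the orbit. Both the orbit and `C` are homogeneous, so each has the dimension of any nonempty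
open subset (`topologicalKrullDim_orbit`), and `dim C` is the Krull dimension of an affine space.

The codimension of `A` is counted in matrix entries of an adapted basis. Inside the upper triangular
matrices, preserving `U` kills one entry for each box of `Y₁`. Preserving `W` then imposes one
equation for each pair `(i, j)` with `i ∉ β ∪ γ`, `j ∈ β ∪ γ`; it involves only entries in rows `i`,
`σ i` and columns `j`, `σ j`, where `σ i` enters only if `σ i ∈ γ` and `σ j` only if `j ∈ γ`.
Different pairs involve disjoint sets of entries, so the rank is the number of pairs with an entry
not yet forced to vanish. The entry `(i, j)` accounts for `Y₂ \ Ycom`; the entries `(σ i, j)` and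
`(i, σ j)` add the hooks in `H` (`finrank_stabilizer_add_card_fiberBoxes`).

The adapted basis comes from induction along the flag: a new transposition arises when `U` and `W`
both grow but cannot be given a common new basis vector (`exists_isTruncatedDataOf_succ`). -/

namespace DoubleGr

noncomputable section

open scoped Topology TensorProduct

/-! ### Zariski topology of a vector space: polynomial and rational maps -/

section ZariskiTopology

variable {L : Type*} [Field L] {E E' : Type*} [AddCommGroup E] [Module L E]
  [AddCommGroup E'] [Module L E']

theorem dual_mem_polyFun (φ : Module.Dual L E) : (φ : E → L) ∈ polyFun L E :=
  Algebra.subset_adjoin ⟨φ, rfl⟩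

theorem const_mem_polyFun (a : L) : (fun _ : E => a) ∈ polyFun L E :=
  (polyFun L E).algebraMap_mem a

theorem isTopologicalBasis_zariski :
    @TopologicalSpace.IsTopologicalBasis E (zariski L E)
      {s | ∃ f ∈ polyFun L E, s = {x | f x ≠ 0}} := by
  let _ := zariski L E
  refine ⟨?_, ?_, rfl⟩
  · rintro _ ⟨f, hf, rfl⟩ _ ⟨g, hg, rfl⟩ x hx
    refine ⟨_, ⟨f * g, mul_mem hf hg, rfl⟩, ?_, ?_⟩
    · exact mul_ne_zero hx.1 hx.2
    · intro y hy
      exact ⟨left_ne_zero_of_mul hy, right_ne_zero_of_mul hy⟩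
  · refine Set.eq_univ_of_forall fun x => ?_
    exact ⟨_, ⟨1, one_mem _, rfl⟩, by simp⟩

theorem isOpen_zariski_iff {s : Set E} :
    IsOpen[zariski L E] s ↔ ∀ x ∈ s, ∃ f ∈ polyFun L E, f x ≠ 0 ∧ ∀ y, f y ≠ 0 → y ∈ s := by
  let _ := zariski L E
  rw [isTopologicalBasis_zariski.isOpen_iff]
  constructor
  · intro h x hx
    obtain ⟨_, ⟨f, hf, rfl⟩, h1, h2⟩ := h x hx
    exact ⟨f, hf, h1, fun y hy => h2 hy⟩
  · intro h x hx
    obtain ⟨f, hf, h1, h2⟩ := h x hx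
    exact ⟨_, ⟨f, hf, rfl⟩, h1, fun y hy => h2 y hy⟩

theorem isOpen_zariski_ne_zero {f : E → L} (hf : f ∈ polyFun L E) :
    IsOpen[zariski L E] {x | f x ≠ 0} :=
  isOpen_zariski_iff.2 fun _ hx => ⟨f, hf, hx, fun _ hy => hy⟩

/-- Clearing denominators in the composition of a polynomial function with a rational map. -/
theorem exists_pow_mul_comp_mem_polyFun {δ : E → L} (hδ : δ ∈ polyFun L E) {c : E → E'}
    (hc : ∀ φ : Module.Dual L E', ∃ g ∈ polyFun L E, ∀ x, δ x ≠ 0 → δ x * φ (c x) = g x)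
    {f : E' → L} (hf : f ∈ polyFun L E') :
    ∃ N : ℕ, ∃ g ∈ polyFun L E, ∀ x, δ x ≠ 0 → δ x ^ N * f (c x) = g x := by
  induction hf using Algebra.adjoin_induction with
  | mem f hf =>
    obtain ⟨φ, rfl⟩ := hf
    obtain ⟨g, hg, h⟩ := hc φ
    exact ⟨1, g, hg, fun x hx => by rw [pow_one, h x hx]⟩
  | algebraMap a => exact ⟨0, _, const_mem_polyFun a, fun x _ => by simp⟩
  | add f₁ f₂ _ _ h₁ h₂ =>
    obtain ⟨N₁, g₁, hg₁, h₁⟩ := h₁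
    obtain ⟨N₂, g₂, hg₂, h₂⟩ := h₂
    refine ⟨N₁ + N₂, δ ^ N₂ * g₁ + δ ^ N₁ * g₂,
      add_mem (mul_mem (pow_mem hδ _) hg₁) (mul_mem (pow_mem hδ _) hg₂), fun x hx => ?_⟩
    simp only [Pi.add_apply, Pi.mul_apply, Pi.pow_apply, ← h₁ x hx, ← h₂ x hx]
    ring
  | mul f₁ f₂ _ _ h₁ h₂ =>
    obtain ⟨N₁, g₁, hg₁, h₁⟩ := h₁
    obtain ⟨N₂, g₂, hg₂, h₂⟩ := h₂
    refine ⟨N₁ + N₂, g₁ * g₂, mul_mem hg₁ hg₂, fun x hx => ?_⟩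
    simp only [Pi.mul_apply, ← h₁ x hx, ← h₂ x hx]
    ring

theorem isOpen_preimage_of_rational {δ : E → L} (hδ : δ ∈ polyFun L E) {c : E → E'}
    (hc : ∀ φ : Module.Dual L E', ∃ g ∈ polyFun L E, ∀ x, δ x ≠ 0 → δ x * φ (c x) = g x)
    {s : Set E'} (hs : IsOpen[zariski L E'] s) :
    IsOpen[zariski L E] {x | δ x ≠ 0 ∧ c x ∈ s} := by
  rw [isOpen_zariski_iff] at hs ⊢
  rintro x ⟨hx, hxs⟩
  obtain ⟨f, hf, hfx, hfs⟩ := hs _ hxs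
  obtain ⟨N, g, hg, hgc⟩ := exists_pow_mul_comp_mem_polyFun hδ hc hf
  refine ⟨δ * g, mul_mem hδ hg, ?_, fun y hy => ?_⟩
  · rw [Pi.mul_apply, ← hgc x hx]
    exact mul_ne_zero hx (mul_ne_zero (pow_ne_zero _ hx) hfx)
  · have hy1 : δ y ≠ 0 := left_ne_zero_of_mul hy
    have hy2 : g y ≠ 0 := right_ne_zero_of_mul hy
    rw [← hgc y hy1] at hy2
    exact ⟨hy1, hfs _ (right_ne_zero_of_mul hy2)⟩

theorem continuous_of_polynomial {c : E → E'}
    (hc : ∀ φ : Module.Dual L E', (fun x => φ (c x)) ∈ polyFun L E) :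
    @Continuous E E' (zariski L E) (zariski L E') c := by
  let _ := zariski L E
  let _ := zariski L E'
  refine ⟨fun s hs => ?_⟩
  have h := isOpen_preimage_of_rational (one_mem (polyFun L E)) (c := c)
    (fun φ => ⟨_, hc φ, fun x _ => by simp⟩) hs
  simp only [Pi.one_apply, ne_eq, one_ne_zero, not_false_eq_true, true_and] at h
  exact h

theorem continuous_affine (f : E →ₗ[L] E') (a : E') :
    @Continuous E E' (zariski L E) (zariski L E') fun x => f x + a := by
  refine continuous_of_polynomial fun φ => ?_
  simp only [map_add]
  exact add_mem (dual_mem_polyFun (φ.comp f)) (const_mem_polyFun _)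

/-- Translations are homeomorphisms. -/
def zariskiTranslation (a : E) : @Homeomorph E E (zariski L E) (zariski L E) :=
  letI := zariski L E
  { Equiv.addRight a with
    continuous_toFun := continuous_affine LinearMap.id a
    continuous_invFun := continuous_affine LinearMap.id (-a) }

/-- Linear equivalences are homeomorphisms. -/
def zariskiLinearEquiv (e : E ≃ₗ[L] E') : @Homeomorph E E' (zariski L E) (zariski L E') :=
  letI := zariski L E
  letI := zariski L E'
  { e.toEquiv with
    continuous_toFun := by simpa using continuous_affine (e : E →ₗ[L] E') 0
    continuous_invFun := by simpa using continuous_affine (e.symm : E' →ₗ[L] E) 0 }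

end ZariskiTopology

/-! ### Krull dimension of affine space -/

section ZariskiDimension

open MvPolynomial

variable {L : Type*} [Field L] {σ : Type*} [Finite σ]

theorem mem_polyFun_pi_iff {f : (σ → L) → L} :
    f ∈ polyFun L (σ → L) ↔ ∃ P : MvPolynomial σ L, f = fun x => aeval x P := by
  cases nonempty_fintype σ
  classical
  constructor
  · intro hf
    induction hf using Algebra.adjoin_induction with
    | mem f hf =>
      obtain ⟨φ, rfl⟩ := hf
      refine ⟨∑ i, C (φ (Pi.single i 1)) * X i, funext fun x => ?_⟩
      conv_lhs => rw [← Finset.univ_sum_single x]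
      simp only [map_sum, map_mul, aeval_X, algHom_C, Algebra.algebraMap_self, RingHom.id_apply]
      refine Finset.sum_congr rfl fun i _ => ?_
      rw [mul_comm, ← smul_eq_mul, ← map_smul, ← Pi.single_smul, smul_eq_mul, mul_one]
    | algebraMap a => exact ⟨C a, funext fun x => by simp⟩
    | add f₁ f₂ _ _ h₁ h₂ =>
      obtain ⟨P₁, rfl⟩ := h₁
      obtain ⟨P₂, rfl⟩ := h₂
      exact ⟨P₁ + P₂, funext fun x => by simp⟩
    | mul f₁ f₂ _ _ h₁ h₂ =>
      obtain ⟨P₁, rfl⟩ := h₁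
      obtain ⟨P₂, rfl⟩ := h₂
      exact ⟨P₁ * P₂, funext fun x => by simp⟩
  · rintro ⟨P, rfl⟩
    induction P using MvPolynomial.induction_on with
    | C a => simpa using const_mem_polyFun a
    | add P Q hP hQ =>
      simp only [map_add]
      exact add_mem hP hQ
    | mul_X P i hP =>
      simp only [map_mul, aeval_X]
      exact mul_mem hP (dual_mem_polyFun (LinearMap.proj (R := L) (φ := fun _ => L) i))

theorem isClosed_zariski_zeroLocus (I : Ideal (MvPolynomial σ L)) :
    IsClosed[zariski L (σ → L)] (zeroLocus L I) := by
  let _ := zariski L (σ → L)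
  refine isOpen_compl_iff.1 (isOpen_zariski_iff.2 fun x hx => ?_)
  simp only [Set.mem_compl_iff, mem_zeroLocus_iff, not_forall] at hx
  obtain ⟨P, hP, hx⟩ := hx
  exact ⟨_, mem_polyFun_pi_iff.2 ⟨P, rfl⟩, hx, fun y hy h => hy (h P hP)⟩

theorem zeroLocus_vanishingIdeal_of_isClosed {Z : Set (σ → L)}
    (hZ : IsClosed[zariski L (σ → L)] Z) : zeroLocus L (vanishingIdeal L Z) = Z := by
  let _ := zariski L (σ → L)
  refine Set.Subset.antisymm (fun x hx => ?_) (zeroLocus_vanishingIdeal_le Z)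
  by_contra hxZ
  obtain ⟨f, hf, hfx, hfZ⟩ := isOpen_zariski_iff.1 hZ.isOpen_compl x hxZ
  obtain ⟨P, rfl⟩ := mem_polyFun_pi_iff.1 hf
  refine hfx (hx P fun y hy => ?_)
  by_contra h
  exact hfZ y h hy

theorem isPrime_vanishingIdeal {Z : Set (σ → L)}
    (hZ : @IsIrreducible _ (zariski L (σ → L)) Z) : (vanishingIdeal L Z).IsPrime := by
  let _ := zariski L (σ → L)
  refine ⟨?_, ?_⟩
  · rw [Ideal.ne_top_iff_one]
    intro h
    obtain ⟨x, hx⟩ := hZ.nonempty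
    simpa using h x hx
  · intro P Q hPQ
    by_contra! h
    simp only [mem_vanishingIdeal_iff, not_forall] at h
    obtain ⟨⟨x, hx, hPx⟩, ⟨y, hy, hQy⟩⟩ := h
    obtain ⟨z, hz, hPz, hQz⟩ := hZ.2 {x | aeval x P ≠ 0} {x | aeval x Q ≠ 0}
      (isOpen_zariski_ne_zero (mem_polyFun_pi_iff.2 ⟨P, rfl⟩))
      (isOpen_zariski_ne_zero (mem_polyFun_pi_iff.2 ⟨Q, rfl⟩)) ⟨x, hx, hPx⟩ ⟨y, hy, hQy⟩
    have := hPQ z hz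
    rw [map_mul] at this
    exact mul_ne_zero hPz hQz this

theorem isIrreducible_zeroLocus [IsAlgClosed L] (I : Ideal (MvPolynomial σ L)) [hI : I.IsPrime] :
    @IsIrreducible _ (zariski L (σ → L)) (zeroLocus L I) := by
  let _ := zariski L (σ → L)
  -- The Nullstellensatz; this is where algebraic closedness enters.
  have hv : vanishingIdeal L (zeroLocus L I) = I := IsPrime.vanishingIdeal_zeroLocus I
  refine ⟨?_, ?_⟩
  · rw [Set.nonempty_iff_ne_empty]
    intro h
    rw [h, vanishingIdeal_empty] at hv
    exact hI.ne_top hv.symm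
  · rintro u v hu hv' ⟨x, hx, hxu⟩ ⟨y, hy, hyv⟩
    obtain ⟨f, hf, hfx, hfu⟩ := (isOpen_zariski_iff (L := L)).1 hu x hxu
    obtain ⟨g, hg, hgy, hgv⟩ := (isOpen_zariski_iff (L := L)).1 hv' y hyv
    obtain ⟨P, rfl⟩ := mem_polyFun_pi_iff.1 hf
    obtain ⟨Q, rfl⟩ := mem_polyFun_pi_iff.1 hg
    have hPQ : P * Q ∉ vanishingIdeal L (zeroLocus L I) := by
      rw [hv]
      intro h
      rcases hI.mem_or_mem h with h | h
      · exact hfx (hx P h)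
      · exact hgy (hy Q h)
    simp only [mem_vanishingIdeal_iff, not_forall, map_mul] at hPQ
    obtain ⟨z, hz, hPQz⟩ := hPQ
    exact ⟨z, hz, hfu z (left_ne_zero_of_mul hPQz), hgv z (right_ne_zero_of_mul hPQz)⟩

/-- By the Nullstellensatz, irreducible closed sets correspond to prime ideals of the polynomial
ring with order reversed. Two strictly monotone maps, one in each direction, suffice to compare
chain lengths. -/
theorem topologicalKrullDim_zariski_pi [IsAlgClosed L] :
    @topologicalKrullDim (σ → L) (zariski L (σ → L)) = Nat.card σ := by
  let _ := zariski L (σ → L)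
  have h : ringKrullDim (MvPolynomial σ L) = Nat.card σ := by
    rw [MvPolynomial.ringKrullDim_of_isNoetherianRing, ringKrullDim_eq_zero_of_field, zero_add]
  rw [← h]
  apply le_antisymm
  · unfold topologicalKrullDim ringKrullDim
    rw [← Order.krullDim_orderDual]
    refine Order.krullDim_le_of_strictMono (fun Z => (⟨vanishingIdeal L
      (OrderDual.ofDual Z : TopologicalSpace.IrreducibleCloseds (σ → L)).1,
      isPrime_vanishingIdeal (OrderDual.ofDual Z).2⟩ : PrimeSpectrum (MvPolynomial σ L))) ?_
    refine Monotone.strictMono_of_injective (fun Z Z' h => vanishingIdeal_anti_mono h) ?_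
    intro Z Z' h
    have h' := congrArg (fun I : PrimeSpectrum (MvPolynomial σ L) => zeroLocus L I.asIdeal) h
    simp only at h'
    rw [zeroLocus_vanishingIdeal_of_isClosed (OrderDual.ofDual Z).3,
      zeroLocus_vanishingIdeal_of_isClosed (OrderDual.ofDual Z').3] at h'
    exact TopologicalSpace.IrreducibleCloseds.ext h'
  · unfold topologicalKrullDim ringKrullDim
    rw [← Order.krullDim_orderDual (α := PrimeSpectrum _)]
    refine Order.krullDim_le_of_strictMono (fun I =>
      (⟨zeroLocus L (OrderDual.ofDual I : PrimeSpectrum (MvPolynomial σ L)).asIdeal,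
      isIrreducible_zeroLocus _, isClosed_zariski_zeroLocus _⟩ :
        TopologicalSpace.IrreducibleCloseds (σ → L))) ?_
    refine Monotone.strictMono_of_injective (fun I J h => zeroLocus_anti_mono h) ?_
    intro I J h
    have h' := congrArg (fun Z : TopologicalSpace.IrreducibleCloseds (σ → L) =>
      vanishingIdeal L Z.1) h
    simp only [IsPrime.vanishingIdeal_zeroLocus (K := L)] at h'
    exact PrimeSpectrum.ext h'

theorem topologicalKrullDim_zariski [IsAlgClosed L] {E : Type*} [AddCommGroup E] [Module L E]
    [FiniteDimensional L E] :
    @topologicalKrullDim E (zariski L E) = (Module.finrank L E : ℕ) := by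
  let _ := zariski L E
  let _ := zariski L (Fin (Module.finrank L E) → L)
  have h := (zariskiLinearEquiv (Module.finBasis L E).equivFun).isHomeomorph
  rw [h.topologicalKrullDim_eq, topologicalKrullDim_zariski_pi, Nat.card_fin]

end ZariskiDimension

/-! ### Dimension of homogeneous spaces -/

section Homogeneous

variable {X Y : Type*} [TopologicalSpace X] [TopologicalSpace Y]

/-- A homogeneous space has the same dimension as each nonempty open subspace. -/
theorem topologicalKrullDim_eq_of_isOpenEmbedding [Nonempty X] {f : X → Y}
    (hf : Topology.IsOpenEmbedding f) (hom : ∀ x y : Y, ∃ h : Y ≃ₜ Y, h x = y) :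
    topologicalKrullDim X = topologicalKrullDim Y := by
  refine le_antisymm hf.isInducing.topologicalKrullDim_le ?_
  unfold topologicalKrullDim
  rw [Order.krullDim_eq_iSup_coheight]
  refine iSup_le fun Z => ?_
  obtain ⟨z, hz⟩ := Z.2.nonempty
  -- A homeomorphism moves a point of `Z` into the open image, so the translate of `Z` comes from an
  -- irreducible closed set of `X`. Coheight is preserved by both operations.
  obtain ⟨h, hx⟩ := hom z (f (Classical.arbitrary X))
  let Z' := TopologicalSpace.IrreducibleCloseds.map h h.continuous Z
  have hzZ' : f (Classical.arbitrary X) ∈ Z' := subset_closure ⟨z, hz, hx⟩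
  obtain ⟨T, hT⟩ := (TopologicalSpace.IrreducibleCloseds.orderIsoOfIsOpenEmbedding f hf).surjective
    ⟨Z', ⟨_, hzZ'⟩⟩
  have hT' : TopologicalSpace.IrreducibleCloseds.map f hf.continuous T = Z' :=
    congrArg Subtype.val hT
  rw [← h.isOpenEmbedding.coheight_map Z]
  change ((Order.coheight Z' : ℕ∞) : WithBot ℕ∞) ≤ _
  rw [← hT', hf.coheight_map]
  exact Order.coheight_le_krullDim T

end Homogeneous

/-! ### Linear systems with polynomial coefficients -/

section RationalSolution

variable {L : Type*} [Field L] {H T : Type*} [AddCommGroup H] [Module L H]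
  [AddCommGroup T] [Module L T] [FiniteDimensional L T]

/-- Cramer's rule: the solution of a linear system whose coefficients are polynomial functions
of a parameter is a rational function of the parameter. -/
theorem exists_rational_solution {M : H → Module.End L T}
    (hM : ∀ (t : T) (φ : Module.Dual L T), (fun p => φ (M p t)) ∈ polyFun L H) (t₀ : T) :
    (fun p => LinearMap.det (M p)) ∈ polyFun L H ∧
    ∃ c : H → T, (∀ p, LinearMap.det (M p) ≠ 0 → M p (c p) = t₀) ∧
      ∀ φ : Module.Dual L T, ∃ g ∈ polyFun L H, ∀ p, LinearMap.det (M p) ≠ 0 →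
        LinearMap.det (M p) * φ (c p) = g p := by
  classical
  let b := Module.finBasis L T
  -- The matrix is taken over the ring of polynomial functions, so its determinant and adjugate are
  -- polynomial by construction; `ev p` specializes them at the parameter.
  let N : Matrix (Fin (Module.finrank L T)) (Fin (Module.finrank L T)) (polyFun L H) :=
    fun i j => ⟨fun p => b.coord i (M p (b j)), hM _ _⟩
  let ev : H → (polyFun L H →+* L) := fun p => (Pi.evalRingHom (fun _ => L) p).comp
    (polyFun L H).val.toRingHom
  have hN : ∀ p, (ev p).mapMatrix N = LinearMap.toMatrix b b (M p) := by
    intro p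
    ext i j
    rw [LinearMap.toMatrix_apply]
    rfl
  have hdet : ∀ p, ev p N.det = LinearMap.det (M p) := by
    intro p
    rw [RingHom.map_det, hN, LinearMap.det_toMatrix]
  let s : Fin (Module.finrank L T) → polyFun L H :=
    N.adjugate.mulVec fun i => algebraMap L _ (b.repr t₀ i)
  have hs : ∀ p, (fun i => ev p (s i)) =
      (LinearMap.toMatrix b b (M p)).adjugate.mulVec (b.repr t₀) := by
    intro p
    ext i
    simp only [s, Matrix.mulVec, dotProduct, map_sum, map_mul]
    refine Finset.sum_congr rfl fun j _ => ?_
    rw [← hN, ← RingHom.map_adjugate]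
    rfl
  refine ⟨?_, fun p => (LinearMap.det (M p))⁻¹ • b.equivFun.symm (fun i => ev p (s i)),
    fun p hp => ?_, fun φ => ?_⟩
  · have : (fun p => LinearMap.det (M p)) = ((N.det : polyFun L H) : H → L) := by
      funext p
      rw [← hdet p]
      rfl
    rw [this]
    exact N.det.2
  · rw [map_smul, inv_smul_eq_iff₀ hp]
    apply b.repr.injective
    ext i
    have h1 := LinearMap.toMatrix_mulVec_repr b b (M p) (b.equivFun.symm (fun i => ev p (s i)))
    rw [← congrFun h1 i]
    have h2 : (b.repr (b.equivFun.symm fun i => ev p (s i)) : _ → L) = fun i => ev p (s i) :=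
      b.equivFun.apply_symm_apply _
    rw [h2, hs, Matrix.mulVec_mulVec, Matrix.mul_adjugate, LinearMap.det_toMatrix]
    simp [Matrix.smul_mulVec]
  · refine ⟨_, (∑ i, s i * algebraMap L _ (φ (b i))).2, fun p hp => ?_⟩
    rw [map_smul, smul_eq_mul, mul_inv_cancel_left₀ hp, Module.Basis.equivFun_symm_apply, map_sum]
    change _ = ev p (∑ i, s i * algebraMap L _ (φ (b i)))
    rw [map_sum]
    refine Finset.sum_congr rfl fun i _ => ?_
    rw [map_smul, smul_eq_mul, map_mul]
    rfl

end RationalSolution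

theorem det_ne_zero_iff_injective {L T : Type*} [Field L] [AddCommGroup T] [Module L T]
    [FiniteDimensional L T] {f : Module.End L T} :
    LinearMap.det f ≠ 0 ↔ Function.Injective f := by
  rw [← isUnit_iff_ne_zero, ← LinearMap.isUnit_iff_isUnit_det, LinearMap.isUnit_iff_ker_eq_bot,
    LinearMap.ker_eq_bot]

/-! ### Incidence equations for endomorphisms carrying one pair of subspaces into another -/

section Incidence

variable {L : Type*} [Field L] {E M₁ M₂ : Type*} [AddCommGroup E] [Module L E]
  [AddCommGroup M₁] [Module L M₁] [AddCommGroup M₂] [Module L M₂]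

theorem exists_eq_comp_of_range_le {f P : M₁ →ₗ[L] E} (hP : Function.Injective P)
    (h : LinearMap.range f ≤ LinearMap.range P) : ∃ Y : Module.End L M₁, f = P ∘ₗ Y := by
  obtain ⟨Q, hQ⟩ := P.exists_leftInverse_of_injective (LinearMap.ker_eq_bot.2 hP)
  refine ⟨Q ∘ₗ f, LinearMap.ext fun x => ?_⟩
  obtain ⟨m, hm⟩ := h ⟨x, rfl⟩
  have : Q (P m) = m := LinearMap.congr_fun hQ m
  simp only [LinearMap.comp_apply]
  rw [← hm, this]

/-- For `q` injective, the triples `(x, Y, Z)` in the kernel are the endomorphisms `x ∈ C`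
that map the image of `a` to the image of `q`. -/
def incidence (C : Submodule L (Module.End L E)) (a q : (M₁ →ₗ[L] E) × (M₂ →ₗ[L] E)) :
    C × Module.End L M₁ × Module.End L M₂ →ₗ[L] (M₁ →ₗ[L] E) × (M₂ →ₗ[L] E) where
  toFun t := ((t.1 : Module.End L E) ∘ₗ a.1 - q.1 ∘ₗ t.2.1,
    (t.1 : Module.End L E) ∘ₗ a.2 - q.2 ∘ₗ t.2.2)
  map_add' s t := by
    ext <;> simp <;> abel
  map_smul' r t := by
    ext <;> simp [smul_sub]

variable {C : Submodule L (Module.End L E)} {a q q' : (M₁ →ₗ[L] E) × (M₂ →ₗ[L] E)}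
  {Ψ : (M₁ →ₗ[L] E) × (M₂ →ₗ[L] E) →ₗ[L] C × Module.End L M₁ × Module.End L M₂}

theorem incidence_apply (t : C × Module.End L M₁ × Module.End L M₂) :
    incidence C a q t = ((t.1 : Module.End L E) ∘ₗ a.1 - q.1 ∘ₗ t.2.1,
      (t.1 : Module.End L E) ∘ₗ a.2 - q.2 ∘ₗ t.2.2) := rfl

/-- Two frames of the same subspaces differ by an invertible change of coordinates, which is
absorbed into the unknowns `Y` and `Z`. The component in `C` is untouched, so it depends on the
subspaces only. -/
theorem exists_incidence_eq_of_range_eq (hq : Function.Injective q.1 ∧ Function.Injective q.2)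
    (hq' : Function.Injective q'.1 ∧ Function.Injective q'.2)
    (h₁ : LinearMap.range q'.1 = LinearMap.range q.1)
    (h₂ : LinearMap.range q'.2 = LinearMap.range q.2) :
    ∃ f : C × Module.End L M₁ × Module.End L M₂ →ₗ[L] C × Module.End L M₁ × Module.End L M₂,
      Function.Injective f ∧ (∀ t, (f t).1 = t.1) ∧
      ∀ t, incidence C a q' t = incidence C a q (f t) := by
  obtain ⟨m, hm⟩ := exists_eq_comp_of_range_le hq.1 h₁.le
  obtain ⟨m', hm'⟩ := exists_eq_comp_of_range_le hq.2 h₂.le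
  have im : Function.Injective m := fun x y h => hq'.1 (by rw [hm]; simp [h])
  have im' : Function.Injective m' := fun x y h => hq'.2 (by rw [hm']; simp [h])
  refine ⟨LinearMap.prodMap LinearMap.id (LinearMap.prodMap (LinearMap.mulLeft L m)
    (LinearMap.mulLeft L m')), ?_, fun t => rfl, fun t => ?_⟩
  · rintro ⟨c, Y, Z⟩ ⟨c', Y', Z'⟩ h
    simp only [LinearMap.prodMap_apply, Prod.mk.injEq, LinearMap.id_apply,
      LinearMap.mulLeft_apply] at h
    obtain ⟨h1, h2, h3⟩ := h
    refine Prod.ext h1 (Prod.ext (LinearMap.ext fun x => im ?_) (LinearMap.ext fun x => im' ?_))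
    · exact LinearMap.congr_fun h2 x
    · exact LinearMap.congr_fun h3 x
  · rw [incidence_apply, incidence_apply, hm, hm']
    rfl

/-- Containment gives factorizations `(1 + c) a = q Y` and likewise with `Z`; moving `a` to the
other side turns them into an inhomogeneous linear system. -/
theorem incidence_eq_neg_of_mapsTo {c : C} (hq : Function.Injective q.1 ∧ Function.Injective q.2)
    (h₁ : (LinearMap.range a.1).map (1 + (c : Module.End L E)) ≤ LinearMap.range q.1)
    (h₂ : (LinearMap.range a.2).map (1 + (c : Module.End L E)) ≤ LinearMap.range q.2) :
    ∃ Y Z, incidence C a q (c, Y, Z) = -a := by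
  rw [← LinearMap.range_comp] at h₁ h₂
  obtain ⟨Y, hY⟩ := exists_eq_comp_of_range_le hq.1 h₁
  obtain ⟨Z, hZ⟩ := exists_eq_comp_of_range_le hq.2 h₂
  refine ⟨Y, Z, ?_⟩
  rw [incidence_apply, ← hY, ← hZ]
  ext <;> simp

theorem incidence_eq_zero_of_mapsTo {c : C} (hq : Function.Injective q.1 ∧ Function.Injective q.2)
    (h₁ : (LinearMap.range a.1).map (c : Module.End L E) ≤ LinearMap.range q.1)
    (h₂ : (LinearMap.range a.2).map (c : Module.End L E) ≤ LinearMap.range q.2) :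
    ∃ Y Z, incidence C a q (c, Y, Z) = 0 := by
  rw [← LinearMap.range_comp] at h₁ h₂
  obtain ⟨Y, hY⟩ := exists_eq_comp_of_range_le hq.1 h₁
  obtain ⟨Z, hZ⟩ := exists_eq_comp_of_range_le hq.2 h₂
  refine ⟨Y, Z, ?_⟩
  rw [incidence_apply, ← hY, ← hZ]
  simp

/-- The elements of `b` that preserve `U` and `W`. -/
def stabilizer (b : Submodule L (Module.End L E)) (U W : Submodule L E) :
    Submodule L (Module.End L E) :=
  b ⊓ (U.compatibleMaps U ⊓ W.compatibleMaps W)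

theorem mem_stabilizer {b : Submodule L (Module.End L E)} {U W : Submodule L E}
    {x : Module.End L E} : x ∈ stabilizer b U W ↔ x ∈ b ∧ U.map x ≤ U ∧ W.map x ≤ W := by
  simp only [stabilizer, Submodule.mem_inf, Submodule.map_le_iff_le_comap]
  rfl

/-- A kernel element has its component `c` in both the stabilizer and its complement, so `c = 0`;
injectivity of `a` then kills `Y` and `Z`. The resulting left inverse `Ψ` makes the system square.
-/
theorem injective_incidence_self {b : Submodule L (Module.End L E)} (hCb : C ≤ b)
    (ha : Function.Injective a.1 ∧ Function.Injective a.2)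
    (hC : stabilizer b (LinearMap.range a.1) (LinearMap.range a.2) ⊓ C = ⊥) :
    Function.Injective (incidence C a a) := by
  rw [← LinearMap.ker_eq_bot, LinearMap.ker_eq_bot']
  rintro ⟨c, Y, Z⟩ h
  rw [incidence_apply, Prod.mk_eq_zero, sub_eq_zero, sub_eq_zero] at h
  obtain ⟨h₁, h₂⟩ := h
  have hc : (c : Module.End L E) = 0 := by
    rw [← Submodule.mem_bot L, ← hC]
    refine ⟨mem_stabilizer.2 ⟨hCb c.2, ?_, ?_⟩, c.2⟩
    · rw [← LinearMap.range_comp, h₁]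
      exact LinearMap.range_comp_le_range _ _
    · rw [← LinearMap.range_comp, h₂]
      exact LinearMap.range_comp_le_range _ _
  have hY : Y = 0 := LinearMap.ext fun x => ha.1 (by
    have := LinearMap.congr_fun h₁ x
    simp only [hc] at this
    simpa using this.symm)
  have hZ : Z = 0 := LinearMap.ext fun x => ha.2 (by
    have := LinearMap.congr_fun h₂ x
    simp only [hc] at this
    simpa using this.symm)
  rw [hY, hZ]
  ext <;> simp [hc]

theorem map_range_eq_of_le [FiniteDimensional L M₁] {x : Module.End L E}
    (hx : Function.Injective x) {r s : M₁ →ₗ[L] E}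
    (hr : Function.Injective r) (hs : Function.Injective s)
    (h : (LinearMap.range r).map x ≤ LinearMap.range s) :
    (LinearMap.range r).map x = LinearMap.range s := by
  apply Submodule.eq_of_le_of_finrank_eq h
  rw [← (Submodule.equivMapOfInjective x hx _).finrank_eq, LinearMap.finrank_range_of_inj hr,
    LinearMap.finrank_range_of_inj hs]

variable [FiniteDimensional L E] [FiniteDimensional L M₁] [FiniteDimensional L M₂]

theorem det_ne_zero_of_range_eq (hq : Function.Injective q.1 ∧ Function.Injective q.2)
    (hq' : Function.Injective q'.1 ∧ Function.Injective q'.2)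
    (h₁ : LinearMap.range q'.1 = LinearMap.range q.1)
    (h₂ : LinearMap.range q'.2 = LinearMap.range q.2)
    (hdet : LinearMap.det (Ψ ∘ₗ incidence C a q) ≠ 0) :
    LinearMap.det (Ψ ∘ₗ incidence C a q') ≠ 0 := by
  obtain ⟨f, hf, -, hfq⟩ := exists_incidence_eq_of_range_eq (C := C) (a := a) hq hq' h₁ h₂
  rw [det_ne_zero_iff_injective] at hdet ⊢
  have : Ψ ∘ₗ incidence C a q' = (Ψ ∘ₗ incidence C a q) ∘ₗ f :=
    LinearMap.ext fun t => congrArg Ψ (hfq t)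
  rw [this]
  exact hdet.comp hf

theorem fst_eq_of_range_eq (hq : Function.Injective q.1 ∧ Function.Injective q.2)
    (hq' : Function.Injective q'.1 ∧ Function.Injective q'.2)
    (h₁ : LinearMap.range q'.1 = LinearMap.range q.1)
    (h₂ : LinearMap.range q'.2 = LinearMap.range q.2)
    (hdet : LinearMap.det (Ψ ∘ₗ incidence C a q) ≠ 0)
    {t t' : C × Module.End L M₁ × Module.End L M₂}
    (h : Ψ (incidence C a q t) = Ψ (incidence C a q' t')) : t.1 = t'.1 := by
  obtain ⟨f, -, hf, hfq⟩ := exists_incidence_eq_of_range_eq (C := C) (a := a) hq hq' h₁ h₂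
  rw [hfq] at h
  rw [← hf t']
  exact congrArg Prod.fst (det_ne_zero_iff_injective.1 hdet h)

/-- On the orbit, the rational solution of the incidence equations is an actual solution. -/
theorem map_eq_range_of_solution {b : Subalgebra L (Module.End L E)}
    (hCb : C ≤ Subalgebra.toSubmodule b)
    (hsup : stabilizer (Subalgebra.toSubmodule b) (LinearMap.range a.1) (LinearMap.range a.2) ⊔ C
      = Subalgebra.toSubmodule b)
    (hinf : stabilizer (Subalgebra.toSubmodule b) (LinearMap.range a.1) (LinearMap.range a.2) ⊓ C
      = ⊥)
    (ha : Function.Injective a.1 ∧ Function.Injective a.2)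
    (hq : Function.Injective q.1 ∧ Function.Injective q.2)
    (hdet : LinearMap.det (Ψ ∘ₗ incidence C a q) ≠ 0)
    {t : C × Module.End L M₁ × Module.End L M₂} (ht : Ψ (incidence C a q t) = Ψ (-a))
    (hinj : Function.Injective (1 + (t.1 : Module.End L E) : Module.End L E))
    {g : E ≃ₗ[L] E} (hg : (g : Module.End L E) ∈ b)
    (hg₁ : LinearMap.range q.1 = (LinearMap.range a.1).map (g : E →ₗ[L] E))
    (hg₂ : LinearMap.range q.2 = (LinearMap.range a.2).map (g : E →ₗ[L] E)) :
    (LinearMap.range a.1).map (1 + (t.1 : Module.End L E)) = LinearMap.range q.1 ∧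
    (LinearMap.range a.2).map (1 + (t.1 : Module.End L E)) = LinearMap.range q.2 := by
  set A := stabilizer (Subalgebra.toSubmodule b) (LinearMap.range a.1) (LinearMap.range a.2)
    with hA
  have hΦ := det_ne_zero_iff_injective.1 hdet
  -- `N` is the translate `gA`. All its elements carry the base pair into the pair given by `q`.
  let N : Submodule L (Module.End L E) := A.map (LinearMap.mulLeft L (g : Module.End L E))
  have hN₁ : ∀ x ∈ N, x ∈ b ∧ (LinearMap.range a.1).map x ≤ LinearMap.range q.1 ∧
      (LinearMap.range a.2).map x ≤ LinearMap.range q.2 := by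
    rintro _ ⟨y, hy, rfl⟩
    obtain ⟨hyb, hy₁, hy₂⟩ := mem_stabilizer.1 hy
    refine ⟨mul_mem hg hyb, ?_, ?_⟩
    · rw [hg₁, LinearMap.mulLeft_apply, Module.End.mul_eq_comp, Submodule.map_comp]
      exact Submodule.map_mono hy₁
    · rw [hg₂, LinearMap.mulLeft_apply, Module.End.mul_eq_comp, Submodule.map_comp]
      exact Submodule.map_mono hy₂
  have hNC : N ⊓ C = ⊥ := by
    rw [eq_bot_iff]
    rintro x ⟨hxN, hxC⟩
    obtain ⟨-, h₁, h₂⟩ := hN₁ x hxN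
    obtain ⟨Y, Z, h⟩ := incidence_eq_zero_of_mapsTo (c := ⟨x, hxC⟩) hq h₁ h₂
    have h0 : ((⟨x, hxC⟩, Y, Z) : C × Module.End L M₁ × Module.End L M₂) = 0 := by
      apply hΦ
      rw [LinearMap.comp_apply, h, map_zero, map_zero]
    have := congrArg (fun s => (s.1 : Module.End L E)) h0
    simpa using this
  have hNinj : Function.Injective (LinearMap.mulLeft L (g : Module.End L E)) := by
    intro x y h
    ext v
    exact g.injective (LinearMap.congr_fun h v)
  have hNrank : Module.finrank L N = Module.finrank L A :=
    (Submodule.equivMapOfInjective _ hNinj A).finrank_eq.symm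
  have hNsup : N ⊔ C = Subalgebra.toSubmodule b := by
    apply Submodule.eq_of_le_of_finrank_eq (sup_le (fun x hx => (hN₁ x hx).1) hCb)
    have e1 := Submodule.finrank_sup_add_finrank_inf_eq N C
    have e2 := Submodule.finrank_sup_add_finrank_inf_eq A C
    rw [hNC] at e1
    rw [hsup, hinf, ← hNrank, ← e1] at e2
    exact (Nat.add_right_cancel e2).symm
  -- Writing `1 = x + c` gives `1 - c ∈ N`, a genuine solution of the incidence equations. It also
  -- solves the square system after `Ψ`, whose solution is unique, so it coincides with `t`.
  have h1 : (1 : Module.End L E) ∈ N ⊔ C := by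
    rw [hNsup]
    exact one_mem b
  obtain ⟨x, hx, c, hc, hxc⟩ := Submodule.mem_sup.1 h1
  obtain ⟨-, h₁, h₂⟩ := hN₁ x hx
  have hx' : x = 1 + ((-⟨c, hc⟩ : C) : Module.End L E) := by
    rw [← hxc]
    simp
  rw [hx'] at h₁ h₂
  obtain ⟨Y, Z, h⟩ := incidence_eq_neg_of_mapsTo hq h₁ h₂
  have ht' : t = (-⟨c, hc⟩, Y, Z) := by
    apply hΦ
    rw [LinearMap.comp_apply, LinearMap.comp_apply, ht, h]
  have ht1 : t.1 = -⟨c, hc⟩ := by rw [ht']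
  rw [ht1] at hinj ⊢
  exact ⟨map_range_eq_of_le hinj ha.1 hq.1 h₁, map_range_eq_of_le hinj ha.2 hq.2 h₂⟩

end Incidence

/-! ### Frames and the action of `GL(E)` on the double Grassmannian -/

section OrbitDimension

variable {L : Type*} [Field L] {E : Type*} [AddCommGroup E] [Module L E] {k l : ℕ}

/-- Pairs of tuples of vectors as pairs of linear maps. -/
def frameMaps (L E : Type*) [Field L] [AddCommGroup E] [Module L E] (k l : ℕ) :
    ((Fin k → E) × (Fin l → E)) ≃ₗ[L] (((Fin k → L) →ₗ[L] E) × ((Fin l → L) →ₗ[L] E)) :=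
  LinearEquiv.prodCongr ((Pi.basisFun L (Fin k)).constr L) ((Pi.basisFun L (Fin l)).constr L)

theorem range_frameMaps (p : (Fin k → E) × (Fin l → E)) :
    LinearMap.range (frameMaps L E k l p).1 = Submodule.span L (Set.range p.1) ∧
    LinearMap.range (frameMaps L E k l p).2 = Submodule.span L (Set.range p.2) :=
  ⟨(Pi.basisFun L (Fin k)).constr_range L, (Pi.basisFun L (Fin l)).constr_range L⟩

theorem injective_constr_of_linearIndependent {u : Fin k → E} (hu : LinearIndependent L u) :
    Function.Injective ((Pi.basisFun L (Fin k)).constr L u) := by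
  have h : ((Pi.basisFun L (Fin k)).constr L u) = Fintype.linearCombination L u := by
    refine (Pi.basisFun L (Fin k)).ext fun i => ?_
    rw [Module.Basis.constr_basis, Pi.basisFun_apply, Fintype.linearCombination_apply_single,
      one_smul]
  rw [h]
  exact hu.fintypeLinearCombination_injective

theorem Frames.injective (p : Frames L E k l) :
    Function.Injective (frameMaps L E k l p.1).1 ∧ Function.Injective (frameMaps L E k l p.1).2 :=
  ⟨injective_constr_of_linearIndependent p.2.1, injective_constr_of_linearIndependent p.2.2⟩

theorem Frames.toGr_fst (p : Frames L E k l) :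
    (p.toGr.1).1 = LinearMap.range (frameMaps L E k l p.1).1 := (range_frameMaps p.1).1.symm

theorem Frames.toGr_snd (p : Frames L E k l) :
    (p.toGr.1).2 = LinearMap.range (frameMaps L E k l p.1).2 := (range_frameMaps p.1).2.symm

theorem Frames.toGr_eq_iff {p q : Frames L E k l} : p.toGr = q.toGr ↔
    LinearMap.range (frameMaps L E k l p.1).1 = LinearMap.range (frameMaps L E k l q.1).1 ∧
    LinearMap.range (frameMaps L E k l p.1).2 = LinearMap.range (frameMaps L E k l q.1).2 := by
  rw [← Frames.toGr_fst, ← Frames.toGr_fst, ← Frames.toGr_snd, ← Frames.toGr_snd]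
  exact Subtype.ext_iff.trans Prod.ext_iff

/-- The action of injective endomorphisms on frames. -/
def Frames.map (x : Module.End L E) (hx : Function.Injective x) (p : Frames L E k l) :
    Frames L E k l :=
  ⟨(fun i => x (p.1.1 i), fun i => x (p.1.2 i)),
    p.2.1.map' x (LinearMap.ker_eq_bot.2 hx), p.2.2.map' x (LinearMap.ker_eq_bot.2 hx)⟩

/-- The action of injective endomorphisms on pairs of subspaces. -/
def DoubleGrassmannian.map (x : Module.End L E) (hx : Function.Injective x)
    (P : DoubleGrassmannian L E k l) : DoubleGrassmannian L E k l :=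
  ⟨(P.1.1.map x, P.1.2.map x), by
    rw [← (Submodule.equivMapOfInjective x hx P.1.1).finrank_eq, P.2.1], by
    rw [← (Submodule.equivMapOfInjective x hx P.1.2).finrank_eq, P.2.2]⟩

theorem Frames.toGr_map (x : Module.End L E) (hx : Function.Injective x) (p : Frames L E k l) :
    (p.map x hx).toGr = p.toGr.map x hx := by
  refine Subtype.ext (Prod.ext ?_ ?_)
  · change Submodule.span L (Set.range fun i => x (p.1.1 i)) = (Submodule.span L _).map x
    rw [Submodule.map_span, ← Set.range_comp]
    rfl
  · change Submodule.span L (Set.range fun i => x (p.1.2 i)) = (Submodule.span L _).map x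
    rw [Submodule.map_span, ← Set.range_comp]
    rfl

theorem Frames.continuous_toGr : Continuous (Frames.toGr L E k l) := continuous_coinduced_rng

theorem exists_linearIndependent_span_eq [FiniteDimensional L E] {m : ℕ} {P : Submodule L E}
    (hP : Module.finrank L P = m) :
    ∃ u : Fin m → E, LinearIndependent L u ∧ Submodule.span L (Set.range u) = P := by
  let b := Module.finBasisOfFinrankEq L P hP
  refine ⟨P.subtype ∘ b, b.linearIndependent.map' _ P.ker_subtype, ?_⟩
  rw [Set.range_comp, ← Submodule.map_span, b.span_eq, Submodule.map_subtype_top]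

theorem Frames.surjective_toGr [FiniteDimensional L E] :
    Function.Surjective (Frames.toGr L E k l) := by
  rintro ⟨⟨P, Q⟩, hP, hQ⟩
  obtain ⟨u, hu, huP⟩ := exists_linearIndependent_span_eq hP
  obtain ⟨w, hw, hwQ⟩ := exists_linearIndependent_span_eq hQ
  exact ⟨⟨(u, w), hu, hw⟩, Subtype.ext (Prod.ext huP hwQ)⟩

theorem continuous_frames_map (x : Module.End L E) (hx : Function.Injective x) :
    Continuous (Frames.map (k := k) (l := l) x hx) := by
  let _ := zariski L ((Fin k → E) × (Fin l → E))
  refine continuous_induced_rng.2 ?_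
  have h := continuous_affine (L := L)
    (LinearMap.prodMap (x.compLeft (Fin k)) (x.compLeft (Fin l))) 0
  simp only [add_zero] at h
  exact h.comp continuous_induced_dom

theorem continuous_doubleGrassmannian_map (x : Module.End L E) (hx : Function.Injective x) :
    Continuous (DoubleGrassmannian.map (k := k) (l := l) x hx) := by
  refine continuous_coinduced_dom.2 ?_
  have : DoubleGrassmannian.map x hx ∘ Frames.toGr L E k l =
      Frames.toGr L E k l ∘ Frames.map x hx :=
    funext fun p => (p.toGr_map x hx).symm
  rw [this]
  exact Frames.continuous_toGr.comp (continuous_frames_map x hx)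

/-- The homeomorphism of the double Grassmannian given by an element of `GL(E)`. -/
def DoubleGrassmannian.homeomorph (g : E ≃ₗ[L] E) :
    DoubleGrassmannian L E k l ≃ₜ DoubleGrassmannian L E k l where
  toFun := DoubleGrassmannian.map (g : Module.End L E) g.injective
  invFun := DoubleGrassmannian.map (g.symm : Module.End L E) g.symm.injective
  left_inv P := by
    refine Subtype.ext (Prod.ext ?_ ?_) <;>
    · simp only [DoubleGrassmannian.map, ← Submodule.map_comp]
      simp
  right_inv P := by
    refine Subtype.ext (Prod.ext ?_ ?_) <;>
    · simp only [DoubleGrassmannian.map, ← Submodule.map_comp]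
      simp
  continuous_toFun := continuous_doubleGrassmannian_map _ _
  continuous_invFun := continuous_doubleGrassmannian_map _ _

theorem homeomorph_mem_orbit {B : Subgroup (E ≃ₗ[L] E)} {U W : Submodule L E} {g : E ≃ₗ[L] E}
    (hg : g ∈ B) {P : DoubleGrassmannian L E k l} (hP : P ∈ orbit k l B U W) :
    DoubleGrassmannian.homeomorph g P ∈ orbit k l B U W := by
  obtain ⟨h, hh, hP⟩ := hP
  refine ⟨g * h, mul_mem hg hh, ?_⟩
  change (P.1.1.map _, P.1.2.map _) = _
  rw [hP]
  simp only [← Submodule.map_comp]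
  rfl

theorem mem_orbit_homeomorph_iff {B : Subgroup (E ≃ₗ[L] E)} {U W : Submodule L E} {g : E ≃ₗ[L] E}
    (hg : g ∈ B) (P : DoubleGrassmannian L E k l) :
    P ∈ orbit k l B U W ↔ DoubleGrassmannian.homeomorph g P ∈ orbit k l B U W := by
  refine ⟨homeomorph_mem_orbit hg, fun h => ?_⟩
  have h' := homeomorph_mem_orbit (inv_mem hg) h
  have hP : DoubleGrassmannian.homeomorph g⁻¹ (DoubleGrassmannian.homeomorph g P) = P :=
    (DoubleGrassmannian.homeomorph g).symm_apply_apply P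
  rwa [hP] at h'

/-- For `P = g(U, W)` and `Q = g'(U, W)`, the element `g' g⁻¹` of `B` acts as a homeomorphism of the
orbit moving `P` to `Q`. -/
theorem orbit_homogeneous {B : Subgroup (E ≃ₗ[L] E)} {U W : Submodule L E}
    (P Q : orbit k l B U W) : ∃ h : orbit k l B U W ≃ₜ orbit k l B U W, h P = Q := by
  obtain ⟨g, hg, hP⟩ := P.2
  obtain ⟨g', hg', hQ⟩ := Q.2
  have hmem := mem_orbit_homeomorph_iff (k := k) (l := l) (U := U) (W := W)
    (mul_mem hg' (inv_mem hg))
  refine ⟨(DoubleGrassmannian.homeomorph (g' * g⁻¹)).subtype hmem, Subtype.ext (Subtype.ext ?_)⟩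
  change (P.1.1.1.map _, P.1.1.2.map _) = _
  rw [hP, hQ]
  have : ((g' * g⁻¹ : E ≃ₗ[L] E) : E →ₗ[L] E) ∘ₗ (g : E →ₗ[L] E) = g' := by
    ext v
    exact congrArg g' (g.symm_apply_apply v)
  simp only [← Submodule.map_comp, this]

end OrbitDimension

/-! ### A chart of the orbit and its dimension -/

section OrbitDimension

variable {L : Type*} [Field L] {E : Type*} [AddCommGroup E] [Module L E] {k l : ℕ}

theorem continuous_one_add_map (C : Submodule L (Module.End L E)) (p₀ : Frames L E k l) :
    @Continuous {x : C // Function.Injective (1 + (x : Module.End L E) : Module.End L E)} _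
      (@instTopologicalSpaceSubtype _ _ (zariski L C)) _ fun x => p₀.map _ x.2 := by
  let _ := zariski L C
  let _ := zariski L ((Fin k → E) × (Fin l → E))
  refine continuous_induced_rng.2 ?_
  let f : C →ₗ[L] (Fin k → E) × (Fin l → E) :=
    LinearMap.prod (LinearMap.pi fun i => LinearMap.applyₗ (p₀.1.1 i) ∘ₗ C.subtype)
      (LinearMap.pi fun i => LinearMap.applyₗ (p₀.1.2 i) ∘ₗ C.subtype)
  have h := (continuous_affine f p₀.1).comp
    (continuous_subtype_val (p := fun x : C =>
      Function.Injective (1 + (x : Module.End L E) : Module.End L E)))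
  refine (congrArg Continuous (funext fun x => ?_)).mp h
  refine Prod.ext (funext fun i => ?_) (funext fun i => ?_)
  · exact add_comm _ _
  · exact add_comm _ _

variable [FiniteDimensional L E]

/-- Near a base point, a complement `C` of the stabilizer algebra in `b` parametrizes the orbit
through `x ↦ 1 + x`, and the parameter depends rationally on the frames. -/
theorem exists_orbit_coordinate {b : Subalgebra L (Module.End L E)} {B : Subgroup (E ≃ₗ[L] E)}
    (hB : ∀ g ∈ B, (g : Module.End L E) ∈ b) (p₀ : Frames L E k l)
    {C : Submodule L (Module.End L E)}
    (hsup : stabilizer (Subalgebra.toSubmodule b) p₀.toGr.1.1 p₀.toGr.1.2 ⊔ C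
      = Subalgebra.toSubmodule b)
    (hinf : stabilizer (Subalgebra.toSubmodule b) p₀.toGr.1.1 p₀.toGr.1.2 ⊓ C = ⊥) :
    ∃ (D : Set (Frames L E k l)) (c : Frames L E k l → C), p₀ ∈ D ∧
      (∀ s, IsOpen[zariski L C] s → IsOpen {p | p ∈ D ∧ c p ∈ s}) ∧
      (∀ p q, p.toGr = q.toGr → p ∈ D → q ∈ D ∧ c q = c p) ∧
      (∀ p ∈ D, p.toGr ∈ orbit k l B p₀.toGr.1.1 p₀.toGr.1.2 →
        ∀ h : Function.Injective (1 + (c p : Module.End L E) : Module.End L E),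
        p.toGr = p₀.toGr.map _ h) ∧
      (∀ p ∈ D, ∀ (x : C) (h : Function.Injective (1 + (x : Module.End L E) : Module.End L E)),
        p.toGr = p₀.toGr.map _ h → c p = x) := by
  have hCb : C ≤ Subalgebra.toSubmodule b := hsup ▸ le_sup_right
  rw [Frames.toGr_fst, Frames.toGr_snd] at hsup hinf
  obtain ⟨a, ha⟩ : ∃ a, a = frameMaps L E k l p₀.1 := ⟨_, rfl⟩
  have ha' := p₀.injective
  rw [← ha] at hsup hinf ha'
  -- The incidence system may have more equations than unknowns. Composing with a left inverse at
  -- the base frame makes it square, with determinant `1` at that frame; its coefficients are affine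
  -- in the frame `p`.
  obtain ⟨Ψ, hΨ⟩ := (incidence C a a).exists_leftInverse_of_injective
    (LinearMap.ker_eq_bot.2 (injective_incidence_self hCb ha' hinf))
  obtain ⟨hδ, sol, hsol, hrat⟩ := exists_rational_solution
    (M := fun p : (Fin k → E) × (Fin l → E) => Ψ ∘ₗ incidence C a (frameMaps L E k l p))
    (fun t φ => by
      let f : (Fin k → E) × (Fin l → E) →ₗ[L]
          ((Fin k → L) →ₗ[L] E) × ((Fin l → L) →ₗ[L] E) :=
        (LinearMap.prodMap (LinearMap.lcomp L E t.2.1) (LinearMap.lcomp L E t.2.2)) ∘ₗ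
          (frameMaps L E k l).toLinearMap
      have : (fun p => φ ((Ψ ∘ₗ incidence C a (frameMaps L E k l p)) t)) =
          (fun _ => (φ ∘ₗ Ψ) ((t.1 : Module.End L E) ∘ₗ a.1, (t.1 : Module.End L E) ∘ₗ a.2)) -
            ((φ ∘ₗ Ψ ∘ₗ f : Module.Dual L _) : _ → L) := by
        funext p
        rw [Pi.sub_apply, ← LinearMap.comp_assoc, LinearMap.comp_apply (φ ∘ₗ Ψ) f, ← map_sub]
        rfl
      rw [this]
      exact sub_mem (const_mem_polyFun _) (dual_mem_polyFun _))
    (Ψ (-a))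
  have hrange : ∀ (x : C) (h : Function.Injective (1 + (x : Module.End L E) : Module.End L E))
      (p : Frames L E k l), p.toGr = p₀.toGr.map _ h ↔
      (LinearMap.range a.1).map (1 + (x : Module.End L E)) =
        LinearMap.range (frameMaps L E k l p.1).1 ∧
      (LinearMap.range a.2).map (1 + (x : Module.End L E)) =
        LinearMap.range (frameMaps L E k l p.1).2 := by
    intro x h p
    rw [ha, ← Frames.toGr_fst, ← Frames.toGr_snd, ← Frames.toGr_fst, ← Frames.toGr_snd]
    exact (Subtype.ext_iff.trans Prod.ext_iff).trans (and_congr eq_comm eq_comm)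
  refine ⟨{p | LinearMap.det (Ψ ∘ₗ incidence C a (frameMaps L E k l p.1)) ≠ 0},
    fun p => (sol p.1).1, ?_, ?_, ?_, ?_, ?_⟩
  · change LinearMap.det (Ψ ∘ₗ incidence C a (frameMaps L E k l p₀.1)) ≠ 0
    rw [← ha, hΨ, LinearMap.det_id]
    exact one_ne_zero
  · intro s hs
    have h := isOpen_preimage_of_rational hδ (c := fun p => (sol p).1)
      (fun φ => hrat (φ ∘ₗ LinearMap.fst L _ _)) hs
    exact ⟨_, h, rfl⟩
  · intro p q hpq hp
    obtain ⟨h₁, h₂⟩ := Frames.toGr_eq_iff.1 hpq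
    have hq := det_ne_zero_of_range_eq p.injective q.injective h₁.symm h₂.symm hp
    refine ⟨hq, (fst_eq_of_range_eq p.injective q.injective h₁.symm h₂.symm hp ?_).symm⟩
    exact (hsol _ hp).trans (hsol _ hq).symm
  · rintro p hp ⟨g, hg, hgp⟩ h
    rw [hrange]
    rw [Prod.ext_iff, Frames.toGr_fst, Frames.toGr_snd, Frames.toGr_fst, Frames.toGr_snd,
      ← ha] at hgp
    exact map_eq_range_of_solution hCb hsup hinf ha' p.injective hp (hsol _ hp) h (hB g hg)
      hgp.1 hgp.2
  · intro p hp x h hpx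
    rw [hrange] at hpx
    obtain ⟨Y, Z, hYZ⟩ := incidence_eq_neg_of_mapsTo (c := x) p.injective hpx.1.le hpx.2.le
    refine fst_eq_of_range_eq (t' := (x, Y, Z)) p.injective p.injective rfl rfl hp ?_
    rw [hYZ]
    exact hsol _ hp

theorem isOpen_injective_one_add (C : Submodule L (Module.End L E)) :
    IsOpen[zariski L C] {x | Function.Injective (1 + (x : Module.End L E) : Module.End L E)} := by
  -- Only the polynomiality of the determinant is needed, so the right-hand side `0` is arbitrary.
  have h := (exists_rational_solution (M := fun x : C => 1 + (x : Module.End L E))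
    (fun v φ => by
      simp only [LinearMap.add_apply, map_add]
      exact add_mem (const_mem_polyFun (φ v))
        (dual_mem_polyFun (φ ∘ₗ LinearMap.applyₗ v ∘ₗ C.subtype))) 0).1
  have h' := isOpen_zariski_ne_zero h
  simp only [det_ne_zero_iff_injective] at h'
  exact h'

/-- The map `x ↦ (1 + x) p₀`, on the open set of `x ∈ C` where `1 + x` is invertible and the image
frame lies in the domain `D` of the coordinate `c`, is an open embedding into the orbit with inverse
`c`. That set contains `0`. Homogeneity of the orbit under `B` and of `C` under translations
transfers the dimension. -/
theorem topologicalKrullDim_orbit_eq_finrank [IsAlgClosed L] {b : Subalgebra L (Module.End L E)}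
    {B : Subgroup (E ≃ₗ[L] E)} (hB : ∀ g : E ≃ₗ[L] E, g ∈ B ↔ (g : Module.End L E) ∈ b)
    (p₀ : Frames L E k l) {C : Submodule L (Module.End L E)}
    (hsup : stabilizer (Subalgebra.toSubmodule b) p₀.toGr.1.1 p₀.toGr.1.2 ⊔ C
      = Subalgebra.toSubmodule b)
    (hinf : stabilizer (Subalgebra.toSubmodule b) p₀.toGr.1.1 p₀.toGr.1.2 ⊓ C = ⊥) :
    topologicalKrullDim (orbit k l B p₀.toGr.1.1 p₀.toGr.1.2) = (Module.finrank L C : ℕ) := by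
  obtain ⟨D, c, hp₀, hopen, hsat, hex, huniq⟩ :=
    exists_orbit_coordinate (fun g => (hB g).1) p₀ hsup hinf
  have hCb : C ≤ Subalgebra.toSubmodule b := hsup ▸ le_sup_right
  let _ := zariski L C
  let S₀ : Set C := {x | Function.Injective (1 + (x : Module.End L E) : Module.End L E)}
  have hS₀ : IsOpen S₀ := isOpen_injective_one_add C
  let φ : S₀ → Frames L E k l := fun x => p₀.map _ x.2
  have hφ : Continuous φ := continuous_one_add_map C p₀
  have hD : IsOpen D := by simpa using hopen Set.univ isOpen_univ
  let S : Set S₀ := φ ⁻¹' D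
  have hS : IsOpen S := hD.preimage hφ
  have hφgr : ∀ x : S₀, (φ x).toGr = p₀.toGr.map _ x.2 := fun x => p₀.toGr_map _ x.2
  have hcφ : ∀ x : S, c (φ x.1) = x.1.1 := fun x => huniq _ x.2 _ x.1.2 (hφgr x.1)
  have hφorb : ∀ x : S₀, (φ x).toGr ∈ orbit k l B p₀.toGr.1.1 p₀.toGr.1.2 := by
    intro x
    refine ⟨LinearEquiv.ofInjectiveEndo _ x.2, (hB _).2 ?_, ?_⟩
    · have : ((LinearEquiv.ofInjectiveEndo _ x.2 : E ≃ₗ[L] E) : Module.End L E) =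
          1 + (x.1 : Module.End L E) := rfl
      rw [this]
      exact add_mem (one_mem b) (hCb x.1.2)
    · rw [hφgr]
      rfl
  let τ : S → orbit k l B p₀.toGr.1.1 p₀.toGr.1.2 := fun x => ⟨(φ x.1).toGr, hφorb x.1⟩
  have hτ : Topology.IsOpenEmbedding τ := by
    refine .of_continuous_injective_isOpenMap ?_ ?_ ?_
    · exact (Frames.continuous_toGr.comp (hφ.comp continuous_subtype_val)).subtype_mk _
    · intro x y hxy
      have h := (hsat _ _ (congrArg Subtype.val hxy) x.2).2
      rw [hcφ, hcφ] at h
      exact Subtype.ext (Subtype.ext h.symm)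
    · intro Ω hΩ
      obtain ⟨Ω₁, hΩ₁, rfl⟩ := hΩ
      obtain ⟨Ω₂, hΩ₂, rfl⟩ := hΩ₁
      let G : Set (Frames L E k l) := {p | p ∈ D ∧ c p ∈ S₀ ∩ Ω₂}
      have hG : IsOpen G := hopen _ (hS₀.inter hΩ₂)
      -- `G` is a union of fibres of the quotient map because membership in `D` and the value of `c`
      -- depend only on the spanned subspaces; hence its image is open in the quotient topology.
      have hG' : Frames.toGr L E k l ⁻¹' (Frames.toGr L E k l '' G) = G := by
        refine Set.Subset.antisymm ?_ (Set.subset_preimage_image _ _)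
        rintro p ⟨q, ⟨hqD, hqc⟩, hqp⟩
        obtain ⟨hpD, hpc⟩ := hsat q p hqp hqD
        exact ⟨hpD, by rwa [hpc]⟩
      refine ⟨Frames.toGr L E k l '' G, isOpen_coinduced.2 (by rwa [hG']), ?_⟩
      ext P
      constructor
      · rintro ⟨p, ⟨hpD, hpS, hpΩ⟩, hpP⟩
        have hp : p.toGr = (φ ⟨c p, hpS⟩).toGr := by
          rw [hφgr]
          exact hex p hpD (hpP ▸ P.2) hpS
        exact ⟨⟨⟨c p, hpS⟩, (hsat _ _ hp hpD).1⟩, hpΩ, Subtype.ext (hp.symm.trans hpP)⟩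
      · rintro ⟨x, hx, rfl⟩
        refine ⟨φ x.1, ⟨x.2, ?_⟩, rfl⟩
        rw [hcφ]
        exact ⟨x.1.2, hx⟩
  have h0 : (0 : C) ∈ S₀ := by
    change Function.Injective _
    rw [Submodule.coe_zero, add_zero]
    exact Function.injective_id
  have h0S : (⟨0, h0⟩ : S₀) ∈ S := by
    change φ ⟨0, h0⟩ ∈ D
    have : φ ⟨0, h0⟩ = p₀ := by
      refine Subtype.ext (Prod.ext (funext fun i => ?_) (funext fun i => ?_)) <;>
      simp [φ, Frames.map]
    rwa [this]
  have : Nonempty S := ⟨⟨_, h0S⟩⟩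
  rw [← topologicalKrullDim_eq_of_isOpenEmbedding hτ orbit_homogeneous,
    topologicalKrullDim_eq_of_isOpenEmbedding
      (hS₀.isOpenEmbedding_subtypeVal.comp hS.isOpenEmbedding_subtypeVal) ?_]
  · exact topologicalKrullDim_zariski
  · intro x y
    exact ⟨zariskiTranslation (y - x), add_sub_cancel x y⟩

theorem topologicalKrullDim_orbit [IsAlgClosed L] {b : Subalgebra L (Module.End L E)}
    {B : Subgroup (E ≃ₗ[L] E)} (hB : ∀ g : E ≃ₗ[L] E, g ∈ B ↔ (g : Module.End L E) ∈ b)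
    {U W : Submodule L E} (hU : Module.finrank L U = k) (hW : Module.finrank L W = l) {d : ℕ}
    (hd : Module.finrank L (stabilizer (Subalgebra.toSubmodule b) U W) + d = Module.finrank L b) :
    topologicalKrullDim (orbit k l B U W) = d := by
  obtain ⟨p₀, hp₀⟩ := Frames.surjective_toGr ⟨(U, W), hU, hW⟩
  have hU₀ : p₀.toGr.1.1 = U := by rw [hp₀]
  have hW₀ : p₀.toGr.1.2 = W := by rw [hp₀]
  subst hU₀ hW₀
  set A := stabilizer (Subalgebra.toSubmodule b) p₀.toGr.1.1 p₀.toGr.1.2 with hA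
  have hAb : A ≤ Subalgebra.toSubmodule b := inf_le_left
  obtain ⟨C, hC⟩ := A.exists_isCompl
  -- By the modular law, a complement of `A` in all endomorphisms cuts out a complement of `A` in
  -- `b`.
  have hsup : A ⊔ C ⊓ Subalgebra.toSubmodule b = Subalgebra.toSubmodule b := by
    rw [← sup_inf_assoc_of_le C hAb, hC.sup_eq_top, top_inf_eq]
  have hinf : A ⊓ (C ⊓ Subalgebra.toSubmodule b) = ⊥ := by
    rw [← inf_assoc, hC.inf_eq_bot, bot_inf_eq]
  rw [topologicalKrullDim_orbit_eq_finrank hB p₀ hsup hinf]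
  have e := Submodule.finrank_sup_add_finrank_inf_eq A (C ⊓ Subalgebra.toSubmodule b)
  rw [hsup, hinf, finrank_bot, add_zero, Subalgebra.finrank_toSubmodule, ← hd] at e
  rw [Nat.add_left_cancel e]

end OrbitDimension

/-! ### Codimension of the stabilizer as a number of boxes -/

section Counting

variable {L : Type*} [Field L] {E : Type*} [AddCommGroup E] [Module L E]

/-- Linear functionals in independent position on a subspace cut down its dimension by
their number. -/
theorem finrank_inf_add_card {M ι : Type*} [AddCommGroup M] [Module L M] [FiniteDimensional L M]
    (p r : Submodule L M) (Q : Finset ι) (f : ι → Module.Dual L M)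
    (hr : ∀ x, x ∈ r ↔ x ∈ p ∧ ∀ q ∈ Q, f q x = 0)
    (he : ∀ q ∈ Q, ∃ e ∈ p, f q e ≠ 0 ∧ ∀ q' ∈ Q, q' ≠ q → f q' e = 0) :
    Module.finrank L r + Q.card = Module.finrank L p := by
  classical
  let g : p →ₗ[L] (Q → L) := LinearMap.pi fun q => f q ∘ₗ p.subtype
  -- The vectors `e` form, up to scalars, a dual system to the functionals, so the joint map is onto
  -- and rank-nullity applies.
  have hg : LinearMap.range g = ⊤ := by
    rw [eq_top_iff, ← (Pi.basisFun L Q).span_eq, Submodule.span_le]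
    rintro _ ⟨q, rfl⟩
    obtain ⟨e, hep, heq, he'⟩ := he q q.2
    refine ⟨(f q e)⁻¹ • ⟨e, hep⟩, funext fun q' => ?_⟩
    rw [map_smul, Pi.basisFun_apply, Pi.smul_apply]
    change (f q e)⁻¹ * f q' e = _
    by_cases h : q' = q
    · subst h
      rw [inv_mul_cancel₀ heq, Pi.single_eq_same]
    · rw [he' q' q'.2 fun h' => h (Subtype.ext h'), mul_zero, Pi.single_eq_of_ne h]
  have hker : r = (LinearMap.ker g).map p.subtype := by
    ext x
    rw [hr]
    constructor
    · rintro ⟨hx, h⟩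
      exact ⟨⟨x, hx⟩, funext fun q => h q q.2, rfl⟩
    · rintro ⟨y, hy, rfl⟩
      exact ⟨y.2, fun q hq => congrFun hy ⟨q, hq⟩⟩
  have h := LinearMap.finrank_range_add_finrank_ker g
  rw [hg, finrank_top, Module.finrank_fintype_fun_eq_card, Fintype.card_coe] at h
  rw [hker, Submodule.finrank_map_subtype_eq, add_comm, h]

/-- The algebra of endomorphisms that preserve a family of subspaces. -/
def flagAlgebra {n : ℕ} (F : Fin (n + 1) → Submodule L E) : Subalgebra L (Module.End L E) where
  carrier := {x | ∀ i, (F i).map x ≤ F i}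
  mul_mem' := by
    intro x y hx hy i
    rw [Module.End.mul_eq_comp, Submodule.map_comp]
    exact (Submodule.map_mono (hy i)).trans (hx i)
  add_mem' := by
    rintro x y hx hy i _ ⟨v, hv, rfl⟩
    exact add_mem (hx i ⟨v, hv, rfl⟩) (hy i ⟨v, hv, rfl⟩)
  algebraMap_mem' := by
    rintro r i _ ⟨v, hv, rfl⟩
    exact (F i).smul_mem r hv

/-- An automorphism mapping a subspace into itself maps it onto itself by dimension. This makes `B`
the unit group of an algebra. -/
theorem mem_borel_iff [FiniteDimensional L E] {n : ℕ} {F : Fin (n + 1) → Submodule L E}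
    {g : E ≃ₗ[L] E} : g ∈ borel F ↔ (g : Module.End L E) ∈ flagAlgebra F := by
  refine forall_congr' fun i => ⟨fun h => h.le, fun h => ?_⟩
  exact Submodule.eq_of_le_of_finrank_eq h (g.finrank_map_eq _)

variable {n : ℕ} (v : Module.Basis (Fin n) L E)

theorem mem_span_basis_iff {S : Finset (Fin n)} {y : E} :
    y ∈ Submodule.span L {x | ∃ a ∈ S, x = v a} ↔ ∀ i ∉ S, v.coord i y = 0 := by
  have : {x | ∃ a ∈ S, x = v a} = v '' S := by
    ext x
    simp [eq_comm]
  rw [this, v.mem_span_image]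
  simp only [Set.subset_def, Finset.mem_coe, Finsupp.mem_support_iff]
  exact forall_congr' fun i => not_imp_comm

theorem mem_flag_iff {k : Fin (n + 1)} {y : E} :
    y ∈ v.flag k ↔ ∀ i : Fin n, k ≤ i.castSucc → v.coord i y = 0 := by
  rw [Module.Basis.flag, v.mem_span_image]
  simp only [Set.subset_def, Finset.mem_coe, Finsupp.mem_support_iff, Set.mem_ofPred_eq]
  refine forall_congr' fun i => ?_
  rw [← not_lt]
  exact not_imp_comm

theorem mem_flagAlgebra_iff {x : Module.End L E} :
    x ∈ flagAlgebra v.flag ↔ ∀ i j, j < i → v.coord i (x (v j)) = 0 := by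
  constructor
  · intro h i j hij
    have h1 : x (v j) ∈ v.flag j.succ :=
      h _ ⟨v j, v.self_mem_flag j.castSucc_lt_succ, rfl⟩
    exact (mem_flag_iff v).1 h1 i (Fin.castSucc_lt_iff_succ_le.mp hij)
  · rintro h k
    rw [Module.Basis.flag, Submodule.map_span, Submodule.span_le]
    rintro _ ⟨_, ⟨j, hj, rfl⟩, rfl⟩
    refine (mem_flag_iff v).2 fun i hi => h i j ?_
    exact Fin.castSucc_lt_castSucc_iff.1 (lt_of_lt_of_le hj hi)

theorem map_span_basis_le_iff {S : Finset (Fin n)} {x : Module.End L E} :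
    (Submodule.span L {x | ∃ a ∈ S, x = v a}).map x ≤ Submodule.span L {x | ∃ a ∈ S, x = v a} ↔
      ∀ i ∉ S, ∀ j ∈ S, v.coord i (x (v j)) = 0 := by
  constructor
  · intro h i hi j hj
    exact (mem_span_basis_iff v).1 (h ⟨v j, Submodule.subset_span ⟨j, hj, rfl⟩, rfl⟩) i hi
  · intro h
    rw [Submodule.map_span, Submodule.span_le]
    rintro _ ⟨_, ⟨j, hj, rfl⟩, rfl⟩
    exact (mem_span_basis_iff v).2 fun i hi => h i hi j hj

namespace CombData

variable (D : CombData n)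

theorem σ_lt_of_mem {i : Fin n} (h : D.σ i ∈ D.γ) : i < D.σ i := by
  have h1 := D.σ_σ _ h
  have h2 := D.σ_lt _ h
  rwa [D.σ.injective h1] at h2

theorem σ_σ_of_mem {i : Fin n} (h : D.σ i ∈ D.γ) : D.σ (D.σ i) = i :=
  D.σ.injective (D.σ_σ _ h)

/-- The vectors `v b`, `b ∈ β`, and `v c + v (σ c)`, `c ∈ γ`, in terms of their index. -/
def vec (j : Fin n) : E := if j ∈ D.γ then v j + v (D.σ j) else v j

/-- Linear functionals that cut out the second subspace when `i` ranges over the complement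
of `β ∪ γ`. -/
def functional (i : Fin n) : Module.Dual L E :=
  if D.σ i ∈ D.γ then v.coord i - v.coord (D.σ i) else v.coord i

/-- The second subspace of the configuration. -/
def secondSpan : Submodule L E :=
  Submodule.span L ({x | ∃ b ∈ D.β, x = v b} ∪ {x | ∃ c ∈ D.γ, x = v c + v (D.σ c)})

theorem secondSpan_eq :
    D.secondSpan v = Submodule.span L {x | ∃ j ∈ D.β ∪ D.γ, x = D.vec v j} := by
  unfold secondSpan
  congr 1
  ext x
  simp only [Set.mem_union, Set.mem_ofPred_eq, Finset.mem_union, vec]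
  constructor
  · rintro (⟨b, hb, rfl⟩ | ⟨c, hc, rfl⟩)
    · exact ⟨b, Or.inl hb, by rw [if_neg (Finset.disjoint_left.1 D.disjoint_β_γ hb)]⟩
    · exact ⟨c, Or.inr hc, by rw [if_pos hc]⟩
  · rintro ⟨j, hj, rfl⟩
    by_cases hjγ : j ∈ D.γ
    · exact Or.inr ⟨j, hjγ, by rw [if_pos hjγ]⟩
    · exact Or.inl ⟨j, hj.resolve_right hjγ, by rw [if_neg hjγ]⟩

theorem coord_vec (b j : Fin n) :
    v.coord b (D.vec v j) = (if j = b then 1 else 0) +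
      (if j ∈ D.γ ∧ D.σ j = b then 1 else 0) := by
  unfold vec
  by_cases hj : j ∈ D.γ <;> simp [hj, Finsupp.single_apply]

theorem functional_basis (a i : Fin n) :
    D.functional v i (v a) = (if i = a then 1 else 0) -
      (if D.σ i ∈ D.γ ∧ D.σ i = a then 1 else 0) := by
  unfold functional
  by_cases hi : D.σ i ∈ D.γ <;> simp [hi, Finsupp.single_apply, eq_comm]

theorem functional_vec {i j : Fin n} (hi : i ∉ D.β ∪ D.γ) (hj : j ∈ D.β ∪ D.γ) :
    D.functional v i (D.vec v j) = 0 := by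
  have hij : i ≠ j := fun h => hi (h ▸ hj)
  by_cases hjγ : j ∈ D.γ
  · have h1 : (D.σ i ∈ D.γ ∧ D.σ i = j) ↔ i = D.σ j :=
      ⟨fun h => by rw [← h.2, D.σ_σ_of_mem h.1], fun h => by rw [h, D.σ_σ j hjγ]; exact ⟨hjγ, rfl⟩⟩
    rw [vec, if_pos hjγ, map_add, functional_basis, functional_basis]
    simp [h1, hij]
  · have h1 : ¬ (D.σ i ∈ D.γ ∧ D.σ i = j) := fun h => hjγ (h.2 ▸ h.1)
    rw [vec, if_neg hjγ, functional_basis, if_neg hij, if_neg h1, sub_zero]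

theorem mem_secondSpan_iff {y : E} :
    y ∈ D.secondSpan v ↔ ∀ i ∉ D.β ∪ D.γ, D.functional v i y = 0 := by
  rw [secondSpan_eq]
  constructor
  · intro hy i hi
    have : Submodule.span L {x | ∃ j ∈ D.β ∪ D.γ, x = D.vec v j} ≤
        LinearMap.ker (D.functional v i) := by
      rw [Submodule.span_le]
      rintro _ ⟨j, hj, rfl⟩
      exact D.functional_vec v hi hj
    exact this hy
  · intro h
    have hσ : ∀ i j, (j ∈ D.γ ∧ D.σ j = i) ↔ (j = D.σ i ∧ D.σ i ∈ D.γ) := fun i j =>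
      ⟨fun hj => by rw [← hj.2, D.σ_σ j hj.1]; exact ⟨rfl, hj.1⟩,
        fun hj => by rw [hj.1]; exact ⟨hj.2, D.σ_σ_of_mem hj.2⟩⟩
    -- The coordinates of `y` at `β ∪ γ` determine the only candidate combination; at an index `i`
    -- outside `β ∪ γ`, agreement is exactly the vanishing of the functional of `i`.
    have hy : y = ∑ j ∈ D.β ∪ D.γ, v.coord j y • D.vec v j := by
      refine v.ext_elem fun i => ?_
      change v.coord i y = v.coord i _
      simp only [map_sum, map_smul, coord_vec, hσ, smul_eq_mul, mul_add, mul_ite, mul_one,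
        mul_zero, Finset.sum_add_distrib, Finset.sum_ite_eq', ite_and]
      by_cases hi : i ∈ D.β ∪ D.γ
      · have hσi : D.σ i ∉ D.γ := by
          intro hσi
          have h1 := D.σ_σ_of_mem hσi
          rcases Finset.mem_union.1 hi with hi | hi
          · exact D.σ_notMem_β _ hσi (h1.symm ▸ hi)
          · exact D.σ_notMem_α _ hσi (h1.symm ▸ D.γ_subset_α hi)
        simp [hi, hσi]
      · have h1 := h i hi
        unfold functional at h1
        by_cases hσi : D.σ i ∈ D.γ
        · rw [if_pos hσi, LinearMap.sub_apply, sub_eq_zero] at h1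
          simp [hi, hσi] at h1 ⊢
          exact h1
        · rw [if_neg hσi] at h1
          simp [hi, hσi] at h1 ⊢
          exact h1
    rw [hy]
    exact Submodule.sum_mem _ fun j hj => Submodule.smul_mem _ _ (Submodule.subset_span ⟨j, hj, rfl⟩)

theorem map_secondSpan_le_iff {x : Module.End L E} :
    (D.secondSpan v).map x ≤ D.secondSpan v ↔
      ∀ i ∉ D.β ∪ D.γ, ∀ j ∈ D.β ∪ D.γ, D.functional v i (x (D.vec v j)) = 0 := by
  constructor
  · intro h i hi j hj
    refine (D.mem_secondSpan_iff v).1 (h ⟨_, ?_, rfl⟩) i hi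
    rw [secondSpan_eq]
    exact Submodule.subset_span ⟨j, hj, rfl⟩
  · intro h
    rw [Submodule.map_le_iff_le_comap]
    conv_lhs => rw [secondSpan_eq]
    rw [Submodule.span_le]
    rintro _ ⟨j, hj, rfl⟩
    exact (D.mem_secondSpan_iff v).2 fun i hi => h i hi j hj

/-- The boxes that are counted by the second projection of the orbit. -/
def fiberBoxes : Finset (Fin n × Fin n) := (D.Y₂ \ D.Ycom) ∪ D.H

theorem Ycom_subset_Y₂ : D.Ycom ⊆ D.Y₂ := by
  intro p hp
  simp only [Ycom, Y₂, commonDiagram, diagram, Finset.mem_filter, Finset.mem_univ,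
    true_and] at hp ⊢
  exact ⟨hp.1.2, hp.2.1.2, hp.2.2⟩

theorem H_subset_Ycom : D.H ⊆ D.Ycom :=
  Finset.biUnion_subset.2 fun _ _ => Finset.filter_subset _ _

/-- As `H ⊆ Ycom ⊆ Y₂`, the union is disjoint and the subtraction of natural numbers is not
truncated. -/
theorem card_Y₁_add_card_fiberBoxes :
    D.Y₁.card + D.fiberBoxes.card = D.Y₁.card + D.Y₂.card - D.Ycom.card + D.H.card := by
  have h1 : D.fiberBoxes.card = (D.Y₂ \ D.Ycom).card + D.H.card :=
    Finset.card_union_of_disjoint (Finset.sdiff_disjoint.mono_right D.H_subset_Ycom)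
  have h2 := Finset.card_sdiff_add_card_eq_card D.Ycom_subset_Y₂
  omega

theorem mem_Ycom_iff {i j : Fin n} (hi : i ∉ D.β ∪ D.γ) (hj : j ∈ D.β ∪ D.γ) :
    (i, j) ∈ D.Ycom ↔ i ∉ D.α ∧ j ∈ D.α ∧ i < j := by
  simp only [Ycom, commonDiagram, Finset.mem_filter, Finset.mem_univ, true_and]
  tauto

/-- The condition `σ i ∈ γ` says that column `i` has a dot, in row `σ i`; `j ∈ γ` says that row `j`
has one, in column `σ j`. The inequality `i < j` is automatic from `i < σ i ≤ j` or `i ≤ σ j < j`.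
-/
theorem mem_H_iff {i j : Fin n} (hi : i ∉ D.β ∪ D.γ) (hj : j ∈ D.β ∪ D.γ) :
    (i, j) ∈ D.H ↔ (i ∉ D.α ∧ j ∈ D.α) ∧
      ((D.σ i ∈ D.γ ∧ D.σ i ≤ j) ∨ (j ∈ D.γ ∧ i ≤ D.σ j)) := by
  simp only [H, dots, inwardHook, Finset.mem_biUnion, Finset.mem_image, Finset.mem_filter,
    D.mem_Ycom_iff hi hj]
  constructor
  · rintro ⟨_, ⟨c, hc, rfl⟩, ⟨hiα, hjα, hij⟩, h⟩
    refine ⟨⟨hiα, hjα⟩, ?_⟩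
    rcases h with h | ⟨h1, h2⟩ | ⟨h1, h2⟩
    · rw [Prod.mk.injEq] at h
      rw [h.1, h.2]
      exact Or.inr ⟨hc, le_rfl⟩
    · simp only at h1 h2
      rw [h1, D.σ_σ c hc]
      exact Or.inl ⟨hc, h2.le⟩
    · simp only at h1 h2
      rw [h1]
      exact Or.inr ⟨hc, h2.le⟩
  · rintro ⟨⟨hiα, hjα⟩, ⟨h1, h2⟩ | ⟨h1, h2⟩⟩
    · refine ⟨_, ⟨D.σ i, h1, rfl⟩, ⟨hiα, hjα, (D.σ_lt_of_mem h1).trans_le h2⟩, ?_⟩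
      rw [D.σ_σ_of_mem h1]
      rcases h2.eq_or_lt with h | h
      · exact Or.inl (by rw [h])
      · exact Or.inr (Or.inl ⟨rfl, h⟩)
    · refine ⟨_, ⟨j, h1, rfl⟩, ⟨hiα, hjα, h2.trans_lt (D.σ_lt j h1)⟩, ?_⟩
      rcases h2.eq_or_lt with h | h
      · exact Or.inl (by rw [h])
      · exact Or.inr (Or.inr ⟨rfl, h⟩)

theorem mem_fiberBoxes_iff {i j : Fin n} : (i, j) ∈ D.fiberBoxes ↔
    (i ∉ D.β ∪ D.γ ∧ j ∈ D.β ∪ D.γ) ∧ ((i < j ∧ (i ∈ D.α ∨ j ∉ D.α)) ∨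
      (i ∉ D.α ∧ j ∈ D.α ∧ D.σ i ∈ D.γ ∧ D.σ i ≤ j) ∨
      (i ∉ D.α ∧ j ∈ D.α ∧ j ∈ D.γ ∧ i ≤ D.σ j)) := by
  by_cases h : i ∉ D.β ∪ D.γ ∧ j ∈ D.β ∪ D.γ
  · have hY₂ : (i, j) ∈ D.Y₂ ↔ i < j := by
      simp only [Y₂, diagram, Finset.mem_filter, Finset.mem_univ, true_and]
      tauto
    rw [fiberBoxes, Finset.mem_union, Finset.mem_sdiff, hY₂, D.mem_Ycom_iff h.1 h.2,
      D.mem_H_iff h.1 h.2]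
    tauto
  · have : (i, j) ∉ D.fiberBoxes := by
      intro hmem
      have : (i, j) ∈ D.Y₂ := by
        rcases Finset.mem_union.1 hmem with h' | h'
        · exact (Finset.mem_sdiff.1 h').1
        · exact D.Ycom_subset_Y₂ (D.H_subset_Ycom h')
      simp only [Y₂, diagram, Finset.mem_filter, Finset.mem_univ, true_and] at this
      exact h ⟨this.1, this.2.1⟩
    tauto

/-- The pair `(a, b)` is a matrix entry occurring in the equation of the box and left free by the
flag and `U`. Since `γ ⊆ α` and `σ(γ)` avoids `α`, the entries `(σ i, j)` and `(i, σ j)` are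
constrained only by triangularity. -/
theorem exists_pivot {i j : Fin n} (hq : (i, j) ∈ D.fiberBoxes) :
    ∃ a b, (a = i ∨ (D.σ i ∈ D.γ ∧ a = D.σ i)) ∧ (b = j ∨ (j ∈ D.γ ∧ b = D.σ j)) ∧
      a ≤ b ∧ (a ∈ D.α ∨ b ∉ D.α) := by
  obtain ⟨-, ⟨h, h'⟩ | ⟨-, -, h, h'⟩ | ⟨-, -, h, h'⟩⟩ := D.mem_fiberBoxes_iff.1 hq
  · exact ⟨i, j, Or.inl rfl, Or.inl rfl, h.le, h'⟩
  · exact ⟨D.σ i, j, Or.inr ⟨h, rfl⟩, Or.inl rfl, h', Or.inl (D.γ_subset_α h)⟩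
  · exact ⟨i, D.σ j, Or.inl rfl, Or.inr ⟨h, rfl⟩, h', Or.inr (D.σ_notMem_α j h)⟩

/-- The sets of rows used by distinct `i` outside `β ∪ γ` are disjoint. Together with its analogue
for columns, this makes the equations of different boxes involve disjoint sets of entries. -/
theorem row_unique {i i' a : Fin n} (hi : i ∉ D.β ∪ D.γ) (hi' : i' ∉ D.β ∪ D.γ)
    (ha : a = i ∨ (D.σ i ∈ D.γ ∧ a = D.σ i)) (ha' : i' = a ∨ (D.σ i' ∈ D.γ ∧ D.σ i' = a)) :
    i' = i := by
  rw [Finset.mem_union, not_or] at hi hi'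
  rcases ha with rfl | ⟨h, rfl⟩
  · rcases ha' with rfl | ⟨h', rfl⟩
    · rfl
    · exact absurd h' hi.2
  · rcases ha' with rfl | ⟨h', h''⟩
    · exact absurd h hi'.2
    · exact D.σ.injective h''

theorem column_unique {j j' b : Fin n} (hj : j ∈ D.β ∪ D.γ) (hj' : j' ∈ D.β ∪ D.γ)
    (hb : b = j ∨ (j ∈ D.γ ∧ b = D.σ j)) (hb' : j' = b ∨ (j' ∈ D.γ ∧ D.σ j' = b)) :
    j' = j := by
  have key : ∀ {c}, c ∈ D.γ → D.σ c ∉ D.β ∪ D.γ := fun hc h =>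
    (Finset.mem_union.1 h).elim (D.σ_notMem_β _ hc)
      fun h => D.σ_notMem_α _ hc (D.γ_subset_α h)
  rcases hb with rfl | ⟨h, rfl⟩
  · rcases hb' with rfl | ⟨h', rfl⟩
    · rfl
    · exact absurd hj (key h')
  · rcases hb' with rfl | ⟨h', h''⟩
    · exact absurd hj' (key h)
    · exact D.σ.injective h''

/-- The functional attached to a box. -/
def boxFunctional (q : Fin n × Fin n) : Module.Dual L (Module.End L E) :=
  D.functional v q.1 ∘ₗ LinearMap.applyₗ (D.vec v q.2)

/-- The matrix units with respect to a basis. -/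
def matrixUnit (a b : Fin n) : Module.End L E := (v.coord b).smulRight (v a)

theorem coord_matrixUnit (a b i j : Fin n) :
    v.coord i (matrixUnit v a b (v j)) = if a = i ∧ b = j then 1 else 0 := by
  simp only [matrixUnit, LinearMap.smulRight_apply, Module.Basis.coord_apply,
    Module.Basis.repr_self, map_smul, Finsupp.single_apply, smul_eq_mul]
  by_cases h1 : a = i <;> by_cases h2 : b = j <;> simp [h1, h2, eq_comm]

theorem boxFunctional_matrixUnit (i j a b : Fin n) :
    D.boxFunctional v (i, j) (matrixUnit v a b) =
      ((if j = b then 1 else 0) + (if j ∈ D.γ ∧ D.σ j = b then 1 else 0)) *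
      ((if i = a then 1 else 0) - (if D.σ i ∈ D.γ ∧ D.σ i = a then 1 else 0)) := by
  change D.functional v i (v.coord b (D.vec v j) • v a) = _
  rw [map_smul, coord_vec, functional_basis, smul_eq_mul]

/-- The endomorphisms that preserve the flag and the first subspace. -/
def firstStabilizer : Submodule L (Module.End L E) :=
  Subalgebra.toSubmodule (flagAlgebra v.flag) ⊓
    (Submodule.span L {x | ∃ a ∈ D.α, x = v a}).compatibleMaps
    (Submodule.span L {x | ∃ a ∈ D.α, x = v a})

theorem mem_firstStabilizer_iff {x : Module.End L E} :
    x ∈ D.firstStabilizer v ↔ ∀ i j, j < i ∨ (i ∉ D.α ∧ j ∈ D.α) → v.coord i (x (v j)) = 0 := by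
  have h1 : x ∈ D.firstStabilizer v ↔ x ∈ flagAlgebra v.flag ∧
      (Submodule.span L {x | ∃ a ∈ D.α, x = v a}).map x ≤
        Submodule.span L {x | ∃ a ∈ D.α, x = v a} := by
    rw [Submodule.map_le_iff_le_comap]
    rfl
  rw [h1, mem_flagAlgebra_iff, map_span_basis_le_iff]
  constructor
  · rintro ⟨h, h'⟩ i j (hij | ⟨hi, hj⟩)
    · exact h i j hij
    · exact h' i hi j hj
  · intro h
    exact ⟨fun i j hij => h i j (Or.inl hij), fun i hi j hj => h i j (Or.inr ⟨hi, hj⟩)⟩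

/-- On upper triangular matrices, preserving `U` means the vanishing of the entries at the boxes of
`Y₁`, for which the matrix units are a dual system. -/
theorem finrank_firstStabilizer [FiniteDimensional L E] :
    Module.finrank L (D.firstStabilizer v) + D.Y₁.card = Module.finrank L (flagAlgebra v.flag) := by
  refine finrank_inf_add_card (Subalgebra.toSubmodule (flagAlgebra v.flag)) _ D.Y₁
    (fun q => v.coord q.1 ∘ₗ LinearMap.applyₗ (v q.2)) (fun x => ?_) ?_
  · rw [mem_firstStabilizer_iff, Subalgebra.mem_toSubmodule, mem_flagAlgebra_iff]
    constructor
    · refine fun h => ⟨fun i j hij => h i j (Or.inl hij), fun q hq => h _ _ (Or.inr ?_)⟩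
      simp only [Y₁, diagram, Finset.mem_filter] at hq
      exact ⟨hq.2.1, hq.2.2.1⟩
    · rintro ⟨h, h'⟩ i j hij
      by_cases hlt : j < i
      · exact h i j hlt
      · obtain ⟨hi, hj⟩ := hij.resolve_left hlt
        refine h' (i, j) ?_
        simp only [Y₁, diagram, Finset.mem_filter, Finset.mem_univ, true_and]
        exact ⟨hi, hj, lt_of_le_of_ne (not_lt.1 hlt) fun h => hi (h ▸ hj)⟩
  · rintro ⟨i, j⟩ hq
    simp only [Y₁, diagram, Finset.mem_filter, Finset.mem_univ, true_and] at hq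
    refine ⟨matrixUnit v i j, (mem_flagAlgebra_iff v).2 fun a b hab => ?_, ?_, ?_⟩
    · rw [coord_matrixUnit, if_neg]
      rintro ⟨rfl, rfl⟩
      exact absurd hq.2.2 hab.not_gt
    · change v.coord i (matrixUnit v i j (v j)) ≠ 0
      rw [coord_matrixUnit, if_pos ⟨rfl, rfl⟩]
      exact one_ne_zero
    · rintro ⟨a, b⟩ - hab
      change v.coord a (matrixUnit v i j (v b)) = 0
      rw [coord_matrixUnit, if_neg]
      rintro ⟨rfl, rfl⟩
      exact hab rfl

/-- The equations for preserving `W` have disjoint supports in the matrix entries, so those not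
identically zero on `firstStabilizer` are independent. They are the ones indexed by `fiberBoxes`:
elsewhere all entries involved already vanish, and on `fiberBoxes` the matrix unit at a pivot
detects its own box only. -/
theorem finrank_stabilizer_add_card_fiberBoxes [FiniteDimensional L E] :
    Module.finrank L (stabilizer (Subalgebra.toSubmodule (flagAlgebra v.flag))
      (Submodule.span L {x | ∃ a ∈ D.α, x = v a}) (D.secondSpan v)) + D.fiberBoxes.card =
    Module.finrank L (D.firstStabilizer v) := by
  refine finrank_inf_add_card _ _ D.fiberBoxes (D.boxFunctional v) (fun x => ?_) ?_
  · have h1 : x ∈ stabilizer (Subalgebra.toSubmodule (flagAlgebra v.flag))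
        (Submodule.span L {x | ∃ a ∈ D.α, x = v a}) (D.secondSpan v) ↔
        x ∈ D.firstStabilizer v ∧ (D.secondSpan v).map x ≤ D.secondSpan v := by
      rw [stabilizer, ← inf_assoc, Submodule.map_le_iff_le_comap]
      rfl
    rw [h1, map_secondSpan_le_iff]
    refine and_congr_right fun hx => ⟨fun h q hq => ?_, fun h i hi j hj => ?_⟩
    · obtain ⟨⟨hi, hj⟩, -⟩ := D.mem_fiberBoxes_iff.1 hq
      exact h _ hi _ hj
    · by_cases hq : (i, j) ∈ D.fiberBoxes
      · exact h _ hq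
      · rw [mem_firstStabilizer_iff] at hx
        rw [mem_fiberBoxes_iff] at hq
        have hγα : ∀ {c}, c ∈ D.γ → c ∈ D.α := fun hc => D.γ_subset_α hc
        have hne : i ≠ j := fun h => hi (h ▸ hj)
        have h₀₀ : v.coord i (x (v j)) = 0 := hx i j (by grind)
        have h₁₀ : D.σ i ∈ D.γ → v.coord (D.σ i) (x (v j)) = 0 := fun h =>
          hx _ _ (by have := D.σ_lt_of_mem h; grind)
        have h₀₁ : j ∈ D.γ → v.coord i (x (v (D.σ j))) = 0 := fun h =>
          hx _ _ (by have := D.σ_lt j h; grind)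
        -- This entry creates no further boxes: if it were free then `σ i ≤ σ j < j`, and the entry
        -- `(σ i, j)` would be free as well.
        have h₁₁ : D.σ i ∈ D.γ → j ∈ D.γ → v.coord (D.σ i) (x (v (D.σ j))) = 0 := fun h h' =>
          hx _ _ (by have := D.σ_lt j h'; have := D.σ_lt_of_mem h; grind)
        by_cases h : D.σ i ∈ D.γ <;> by_cases h' : j ∈ D.γ <;>
          simp only [functional, vec, h, h', if_true, if_false, map_add, LinearMap.sub_apply,
            h₀₀, h₁₀, h₀₁, h₁₁, add_zero, sub_zero]
  · rintro ⟨i, j⟩ hq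
    obtain ⟨⟨hi, hj⟩, -⟩ := D.mem_fiberBoxes_iff.1 hq
    obtain ⟨a, b, ha, hb, hab, hα⟩ := D.exists_pivot hq
    refine ⟨matrixUnit v a b, (D.mem_firstStabilizer_iff v).2 fun i' j' h => ?_, ?_, ?_⟩
    · rw [coord_matrixUnit, if_neg]
      rintro ⟨rfl, rfl⟩
      grind
    · rw [boxFunctional_matrixUnit]
      refine mul_ne_zero ?_ ?_
      · rcases hb with rfl | ⟨hjγ, rfl⟩
        · have : ¬ (b ∈ D.γ ∧ D.σ b = b) := fun h => (D.σ_lt b h.1).ne h.2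
          simp [this]
        · simp [hjγ, (D.σ_lt j hjγ).ne']
      · rcases ha with rfl | ⟨hiγ, rfl⟩
        · have : ¬ (D.σ a ∈ D.γ ∧ D.σ a = a) := fun h => (D.σ_lt_of_mem h.1).ne' h.2
          simp [this]
        · simp [hiγ, (D.σ_lt_of_mem hiγ).ne]
    · rintro ⟨i', j'⟩ hq' hne
      obtain ⟨⟨hi', hj'⟩, -⟩ := D.mem_fiberBoxes_iff.1 hq'
      rw [boxFunctional_matrixUnit]
      by_contra h0
      have h1 : j' = b ∨ (j' ∈ D.γ ∧ D.σ j' = b) := by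
        by_contra! h
        have h2 : ¬ (j' ∈ D.γ ∧ D.σ j' = b) := fun h' => h.2 h'.1 h'.2
        simp [h.1, h2] at h0
      have h2 : i' = a ∨ (D.σ i' ∈ D.γ ∧ D.σ i' = a) := by
        by_contra! h
        have h2 : ¬ (D.σ i' ∈ D.γ ∧ D.σ i' = a) := fun h' => h.2 h'.1 h'.2
        simp [h.1, h2] at h0
      refine hne (Prod.ext (D.row_unique hi hi' ha h2) (D.column_unique hj hj' hb h1))

end CombData

end Counting

/-! ### Passage to the algebraically closed field -/

section ScalarExtension

variable {K V : Type*} [Field K] [AddCommGroup V] [Module K V] (L : Type*) [Field L] [Algebra K L]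

theorem finrank_submodule_baseChange (U : Submodule K V) :
    Module.finrank L (U.baseChange L) = Module.finrank K U := by
  rw [← (Submodule.toBaseChange.toLinearEquiv L U).finrank_eq, Module.finrank_baseChange]

theorem baseChange_flag {n : ℕ} (v : Module.Basis (Fin n) K V) (i : Fin (n + 1)) :
    (v.flag i).baseChange L = (v.baseChange L).flag i := by
  rw [Module.Basis.flag, Submodule.baseChange_span, Module.Basis.flag, ← Set.image_comp]
  congr 1
  refine Set.image_congr fun j _ => ?_
  simp

/-- The base change of an adapted basis is adapted to the extended flag with the same combinatorial
data, so the count of equations applies over `L`. -/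
theorem orbitDim_eq [IsAlgClosed L] [FiniteDimensional K V] {n k l : ℕ}
    {F : Fin (n + 1) → Submodule K V} {U W : Submodule K V}
    (hU : Module.finrank K U = k) (hW : Module.finrank K W = l) {D : CombData n}
    (hD : D.IsDataOf F U W) :
    orbitDim L k l F U W =
      ((D.Y₁.card + D.Y₂.card - D.Ycom.card + D.H.card : ℕ) : WithBot ℕ∞) := by
  obtain ⟨v, hF, hUv, hWv⟩ := hD
  have hF' : (fun i => (F i).baseChange L) = (v.baseChange L).flag := by
    funext i
    rw [hF, baseChange_flag]
  have hU' : U.baseChange L = Submodule.span L {x | ∃ a ∈ D.α, x = v.baseChange L a} := by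
    rw [hUv, Submodule.baseChange_span]
    congr 1
    ext x
    constructor
    · rintro ⟨_, ⟨a, ha, rfl⟩, rfl⟩
      exact ⟨a, ha, by simp⟩
    · rintro ⟨a, ha, rfl⟩
      exact ⟨_, ⟨a, ha, rfl⟩, by simp⟩
  have hW' : W.baseChange L = D.secondSpan (v.baseChange L) := by
    rw [hWv, Submodule.baseChange_span, CombData.secondSpan, Set.image_union]
    congr 2
    · ext x
      constructor
      · rintro ⟨_, ⟨a, ha, rfl⟩, rfl⟩
        exact ⟨a, ha, by simp⟩
      · rintro ⟨a, ha, rfl⟩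
        exact ⟨_, ⟨a, ha, rfl⟩, by simp⟩
    · ext x
      constructor
      · rintro ⟨_, ⟨a, ha, rfl⟩, rfl⟩
        exact ⟨a, ha, by simp [TensorProduct.tmul_add]⟩
      · rintro ⟨a, ha, rfl⟩
        exact ⟨_, ⟨a, ha, rfl⟩, by simp [TensorProduct.tmul_add]⟩
  unfold orbitDim
  rw [hF']
  refine topologicalKrullDim_orbit (fun g => mem_borel_iff)
    (by rw [finrank_submodule_baseChange, hU]) (by rw [finrank_submodule_baseChange, hW]) ?_
  rw [hU', hW', ← D.card_Y₁_add_card_fiberBoxes, ← D.finrank_firstStabilizer (v.baseChange L),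
    ← D.finrank_stabilizer_add_card_fiberBoxes (v.baseChange L)]
  ring

end ScalarExtension

/-! ### Existence of the normal form -/

theorem setOf_insert_eq {V : Type*} {n : ℕ} {f f' : Fin n → V} {S : Finset (Fin n)} {m : Fin n}
    (h : ∀ a ∈ S, f' a = f a) :
    {x | ∃ a ∈ insert m S, x = f' a} = insert (f' m) {x | ∃ a ∈ S, x = f a} := by
  ext x
  simp only [Finset.mem_insert, Set.mem_insert_iff, Set.mem_ofPred_eq, exists_eq_or_imp]
  exact or_congr_right (exists_congr fun a => and_congr_right fun ha => by rw [h a ha])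

theorem setOf_eq_of_eq {V : Type*} {n : ℕ} {f f' : Fin n → V} {S : Finset (Fin n)}
    (h : ∀ a ∈ S, f' a = f a) :
    {x | ∃ a ∈ S, x = f' a} = {x | ∃ a ∈ S, x = f a} := by
  ext x
  exact exists_congr fun a => and_congr_right fun ha => by rw [h a ha]

section NormalForm

variable {K V : Type*} [Field K] [AddCommGroup V] [Module K V]
  {n : ℕ} {F : Fin (n + 1) → Submodule K V}

namespace IsCompleteFlag

theorem inf_succ_eq (hF : IsCompleteFlag F) {i : Fin n} (P : Submodule K V)
    (h : ¬ ∃ x ∈ P, x ∈ F i.succ ∧ x ∉ F i.castSucc) : P ⊓ F i.succ = P ⊓ F i.castSucc := by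
  push Not at h
  exact le_antisymm (fun x hx => ⟨hx.1, h x hx.1 hx.2⟩)
    (inf_le_inf_left _ (hF.mono i.castSucc_le_succ))

variable [FiniteDimensional K V]

theorem succ_eq_sup (hF : IsCompleteFlag F) {i : Fin n} {x : V} (hx : x ∈ F i.succ)
    (hx' : x ∉ F i.castSucc) :
    F i.succ = Submodule.span K {x} ⊔ F i.castSucc := by
  have hle : Submodule.span K {x} ⊔ F i.castSucc ≤ F i.succ :=
    sup_le ((Submodule.span_singleton_le_iff_mem _ _).2 hx) (hF.mono i.castSucc_le_succ)
  refine (Submodule.eq_of_le_of_finrank_le hle ?_).symm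
  have hlt : F i.castSucc < Submodule.span K {x} ⊔ F i.castSucc :=
    lt_of_le_of_ne le_sup_right fun h =>
      hx' (h ▸ Submodule.mem_sup_left (Submodule.mem_span_singleton_self x))
  have := Submodule.finrank_lt_finrank_of_lt hlt
  rw [hF.finrank_eq] at this ⊢
  simpa using this

theorem eq_span_of_adapted (hF : IsCompleteFlag F) {v : Fin n → V}
    (hv : ∀ i, v i ∈ F i.succ ∧ v i ∉ F i.castSucc) (i : Fin (n + 1)) :
    F i = Submodule.span K (v '' {j | j.castSucc < i}) := by
  induction i using Fin.induction with
  | zero =>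
    have h := hF.finrank_eq 0
    rw [Fin.val_zero, Submodule.finrank_eq_zero] at h
    simp [h]
  | succ i ih =>
    rw [hF.succ_eq_sup (hv i).1 (hv i).2, ih, ← Submodule.span_insert, ← Set.image_insert_eq]
    congr 2
    ext j
    simp only [Set.mem_insert_iff, Set.mem_ofPred_eq, Fin.castSucc_lt_castSucc_iff,
      Fin.castSucc_lt_succ_iff, le_iff_eq_or_lt]

/-- One vector from each difference of consecutive flag members always gives an adapted basis. This
allows basis vectors to be replaced individually as long as their leading index is kept. -/
theorem exists_basis_of_adapted (hF : IsCompleteFlag F) {v : Fin n → V}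
    (hv : ∀ i, v i ∈ F i.succ ∧ v i ∉ F i.castSucc) :
    ∃ b : Module.Basis (Fin n) K V, ⇑b = v ∧ ∀ i, F i = b.flag i := by
  have hspan : ⊤ ≤ Submodule.span K (Set.range v) := by
    rw [← hF.top_eq, hF.eq_span_of_adapted hv]
    exact Submodule.span_mono (Set.image_subset_range _ _)
  have hcard : Fintype.card (Fin n) = Module.finrank K V := by
    rw [Fintype.card_fin, ← finrank_top, ← hF.top_eq, hF.finrank_eq, Fin.val_last]
  refine ⟨basisOfTopLeSpanOfCardEqFinrank v hspan hcard, coe_basisOfTopLeSpanOfCardEqFinrank .., ?_⟩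
  intro i
  rw [Module.Basis.flag, coe_basisOfTopLeSpanOfCardEqFinrank, hF.eq_span_of_adapted hv]

theorem exists_adapted (hF : IsCompleteFlag F) (i : Fin n) : ∃ x ∈ F i.succ, x ∉ F i.castSucc := by
  by_contra! h
  have := Submodule.finrank_mono (R := K) h
  rw [hF.finrank_eq, hF.finrank_eq] at this
  simp at this

theorem inf_succ_eq_sup (hF : IsCompleteFlag F) {i : Fin n} {x : V} (P : Submodule K V)
    (hxP : x ∈ P) (hx : x ∈ F i.succ)
    (hx' : x ∉ F i.castSucc) :
    P ⊓ F i.succ = Submodule.span K {x} ⊔ P ⊓ F i.castSucc := by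
  rw [hF.succ_eq_sup hx hx', inf_comm, inf_comm P,
    sup_inf_assoc_of_le _ ((Submodule.span_singleton_le_iff_mem _ _).2 hxP)]

end IsCompleteFlag

namespace CombData

/-- Enlarge the first two index sets by a new largest index. -/
def insertFixed (D : CombData n) (m : Fin n) (hα : ∀ i ∈ D.α, i < m) (p q : Prop)
    [Decidable p] [Decidable q] : CombData n where
  α := if p then insert m D.α else D.α
  β := if q then insert m D.β else D.β
  γ := D.γ
  σ := D.σ
  γ_subset_α := by
    split_ifs
    · exact D.γ_subset_α.trans (Finset.subset_insert _ _)
    · exact D.γ_subset_α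
  disjoint_β_γ := by
    split_ifs
    · exact Finset.disjoint_insert_left.2
        ⟨fun h => (hα m (D.γ_subset_α h)).false, D.disjoint_β_γ⟩
    · exact D.disjoint_β_γ
  σ_lt := D.σ_lt
  σ_notMem_α := by
    intro c hc
    have h : D.σ c ≠ m := ((D.σ_lt c hc).trans (hα c (D.γ_subset_α hc))).ne
    split_ifs
    · exact fun h' => (Finset.mem_insert.1 h').elim h (D.σ_notMem_α c hc)
    · exact D.σ_notMem_α c hc
  σ_notMem_β := by
    intro c hc
    have h : D.σ c ≠ m := ((D.σ_lt c hc).trans (hα c (D.γ_subset_α hc))).ne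
    split_ifs
    · exact fun h' => (Finset.mem_insert.1 h').elim h (D.σ_notMem_β c hc)
    · exact D.σ_notMem_β c hc
  σ_σ := D.σ_σ
  σ_fix := D.σ_fix

/-- Enlarge the involution by a transposition that moves a new largest index. -/
def insertSwap (D : CombData n) (m d : Fin n) (hα : ∀ i ∈ D.α, i < m) (hβ : ∀ i ∈ D.β, i < m)
    (hdm : d < m) (hdα : d ∉ D.α) (hdβ : d ∉ D.β) (hdσ : ∀ c ∈ D.γ, D.σ c ≠ d) : CombData n :=
  have hσ : ∀ c ∈ D.γ, (Equiv.swap m d * D.σ) c = D.σ c := fun c hc =>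
    Equiv.swap_apply_of_ne_of_ne ((D.σ_lt c hc).trans (hα c (D.γ_subset_α hc))).ne (hdσ c hc)
  -- The old involution fixes both `m` and `d`, so the new transposition is disjoint from the old
  -- ones.
  have hσm : D.σ m = m := D.σ_fix m (fun h => (hα m (D.γ_subset_α h)).false)
    fun c hc => ((D.σ_lt c hc).trans (hα c (D.γ_subset_α hc))).ne
  have hσd : D.σ d = d := D.σ_fix d (fun h => hdα (D.γ_subset_α h)) hdσ
  have hσm' : (Equiv.swap m d * D.σ) m = d := by simp [hσm]
  have hσd' : (Equiv.swap m d * D.σ) d = m := by simp [hσd]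
  { α := insert m D.α
    β := D.β
    γ := insert m D.γ
    σ := Equiv.swap m d * D.σ
    γ_subset_α := Finset.insert_subset_insert _ D.γ_subset_α
    disjoint_β_γ := Finset.disjoint_insert_right.2 ⟨fun h => (hβ m h).false, D.disjoint_β_γ⟩
    σ_lt := by
      intro c hc
      rcases Finset.mem_insert.1 hc with rfl | hc
      · rwa [hσm']
      · rw [hσ c hc]
        exact D.σ_lt c hc
    σ_notMem_α := by
      intro c hc
      rw [Finset.mem_insert, not_or]
      rcases Finset.mem_insert.1 hc with rfl | hc
      · rw [hσm']
        exact ⟨hdm.ne, hdα⟩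
      · rw [hσ c hc]
        exact ⟨((D.σ_lt c hc).trans (hα c (D.γ_subset_α hc))).ne, D.σ_notMem_α c hc⟩
    σ_notMem_β := by
      intro c hc
      rcases Finset.mem_insert.1 hc with rfl | hc
      · rwa [hσm']
      · rw [hσ c hc]
        exact D.σ_notMem_β c hc
    σ_σ := by
      intro c hc
      rcases Finset.mem_insert.1 hc with rfl | hc
      · rw [hσm', hσd']
      · rw [hσ c hc, Equiv.Perm.mul_apply, D.σ_σ c hc]
        exact Equiv.swap_apply_of_ne_of_ne (hα c (D.γ_subset_α hc)).ne
          fun h => hdα (h ▸ D.γ_subset_α hc)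
    σ_fix := by
      intro i hi hi'
      rw [Finset.mem_insert, not_or] at hi
      have h := D.σ_fix i hi.2 fun c hc => hσ c hc ▸ hi' c (Finset.mem_insert_of_mem hc)
      rw [Equiv.Perm.mul_apply, h]
      exact Equiv.swap_apply_of_ne_of_ne hi.1
        fun h => hi' m (Finset.mem_insert_self _ _) (hσm'.trans h.symm) }

/-- The data of the configuration obtained by intersection with a member of the flag. -/
def IsTruncatedDataOf (D : CombData n) (F : Fin (n + 1) → Submodule K V) (U W : Submodule K V)
    (m : Fin (n + 1)) : Prop :=
  ∃ v : Module.Basis (Fin n) K V, (∀ i, F i = v.flag i) ∧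
    (∀ i ∈ D.α, i.castSucc < m) ∧ (∀ i ∈ D.β, i.castSucc < m) ∧
    U ⊓ F m = Submodule.span K {x | ∃ a ∈ D.α, x = v a} ∧ W ⊓ F m = D.secondSpan v

variable {U W : Submodule K V}

theorem adapted_of_flag_eq {v : Module.Basis (Fin n) K V} (hv : ∀ i, F i = v.flag i) (i : Fin n) :
    v i ∈ F i.succ ∧ v i ∉ F i.castSucc := by
  rw [hv, hv, v.self_mem_flag_iff, v.self_mem_flag_iff]
  exact ⟨i.castSucc_lt_succ, lt_irrefl _⟩

variable [FiniteDimensional K V]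

/-- Replacing `v m` by `z` leaves the data below `m` intact. The propositions `p` and `q` record
whether `U` and `W` acquire `z`; no new transposition is needed. -/
theorem exists_isTruncatedDataOf_succ_of_pivot (hF : IsCompleteFlag F) {D : CombData n} {m : Fin n}
    (hD : D.IsTruncatedDataOf F U W m.castSucc) {z : V} (hz : z ∈ F m.succ)
    (hz' : z ∉ F m.castSucc) (p q : Prop)
    (hp : p → U ⊓ F m.succ = Submodule.span K {z} ⊔ U ⊓ F m.castSucc)
    (hp' : ¬ p → U ⊓ F m.succ = U ⊓ F m.castSucc)
    (hq : q → W ⊓ F m.succ = Submodule.span K {z} ⊔ W ⊓ F m.castSucc)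
    (hq' : ¬ q → W ⊓ F m.succ = W ⊓ F m.castSucc) :
    ∃ D' : CombData n, D'.IsTruncatedDataOf F U W m.succ := by
  classical
  obtain ⟨v, hv, hα, hβ, hU, hW⟩ := hD
  have hα' : ∀ i ∈ D.α, i < m := hα
  have hβ' : ∀ i ∈ D.β, i < m := hβ
  obtain ⟨b, hb, hbF⟩ := hF.exists_basis_of_adapted (v := Function.update v m z) (fun i => by
    by_cases h : i = m
    · subst h
      rw [Function.update_self]
      exact ⟨hz, hz'⟩
    · rw [Function.update_of_ne h]
      exact adapted_of_flag_eq hv i)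
  have hbm : b m = z := by rw [hb, Function.update_self]
  have hbi : ∀ i < m, b i = v i := fun i hi => by rw [hb, Function.update_of_ne hi.ne]
  have hlt : ∀ {i}, i < m → i.castSucc < m.succ := fun h =>
    (Fin.castSucc_lt_castSucc_iff.2 h).trans m.castSucc_lt_succ
  have hbγ : ∀ c ∈ D.γ, b c + b (D.σ c) = v c + v (D.σ c) := fun c hc => by
    have hc' := hα' c (D.γ_subset_α hc)
    rw [hbi c hc', hbi _ ((D.σ_lt c hc).trans hc')]
  refine ⟨D.insertFixed m hα' p q, b, hbF, ?_, ?_, ?_, ?_⟩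
  · intro i hi
    simp only [insertFixed] at hi
    split_ifs at hi
    · rcases Finset.mem_insert.1 hi with rfl | hi
      · exact i.castSucc_lt_succ
      · exact hlt (hα' i hi)
    · exact hlt (hα' i hi)
  · intro i hi
    simp only [insertFixed] at hi
    split_ifs at hi
    · rcases Finset.mem_insert.1 hi with rfl | hi
      · exact i.castSucc_lt_succ
      · exact hlt (hβ' i hi)
    · exact hlt (hβ' i hi)
  · simp only [insertFixed]
    split_ifs with h
    · rw [hp h, setOf_insert_eq (fun a ha => hbi a (hα' a ha)), Submodule.span_insert, hbm, hU]
    · rw [hp' h, setOf_eq_of_eq (fun a ha => hbi a (hα' a ha)), hU]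
  · simp only [insertFixed, secondSpan]
    rw [setOf_eq_of_eq (f := fun c => v c + v (D.σ c)) hbγ]
    split_ifs with h
    · rw [hq h, setOf_insert_eq (fun a ha => hbi a (hβ' a ha)), Set.insert_union,
        Submodule.span_insert, hbm, hW, secondSpan]
    · rw [hq' h, setOf_eq_of_eq (fun a ha => hbi a (hβ' a ha)), hW, secondSpan]

/-- Here no common new vector is available, and the obstruction is the class of `w - u` modulo the
part of `U + W` already reached. A reduced representative of this class becomes the new `v d`, a
corrected `u` becomes the new `v m`, and `W` acquires `v m + v d`. -/
theorem exists_isTruncatedDataOf_succ_of_not_mem_sup (hF : IsCompleteFlag F) {D : CombData n}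
    {m : Fin n} (hD : D.IsTruncatedDataOf F U W m.castSucc) {u w : V}
    (hu : u ∈ U) (huF : u ∈ F m.succ) (huF' : u ∉ F m.castSucc) (hw : w ∈ W)
    (huw : w - u ∈ F m.castSucc)
    (h : w - u ∉ U ⊓ F m.castSucc ⊔ W ⊓ F m.castSucc) :
    ∃ D' : CombData n, D'.IsTruncatedDataOf F U W m.succ := by
  classical
  obtain ⟨v, hv, hα, hβ, hU, hW⟩ := hD
  have hα' : ∀ i ∈ D.α, i < m := hα
  have hβ' : ∀ i ∈ D.β, i < m := hβ
  set y := w - u with hy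
  -- All `v i` with `i ∈ S` lie in the sum of the truncated `U` and `W`; for `i = σ c`, subtract `v
  -- c ∈ U` from `v c + v (σ c) ∈ W`.
  let S : Finset (Fin n) := D.α ∪ D.β ∪ D.γ.image D.σ
  have hmem : ∀ i ∈ S, v i ∈ U ⊓ F m.castSucc ⊔ W ⊓ F m.castSucc := by
    have hvα : ∀ i ∈ D.α, v i ∈ U ⊓ F m.castSucc ⊔ W ⊓ F m.castSucc := fun i hi => by
      rw [hU]
      exact Submodule.mem_sup_left (Submodule.subset_span ⟨i, hi, rfl⟩)
    intro i hi
    simp only [S, Finset.mem_union, Finset.mem_image] at hi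
    rcases hi with (hi | hi) | ⟨c, hc, rfl⟩
    · exact hvα i hi
    · rw [hW]
      exact Submodule.mem_sup_right (Submodule.subset_span (Or.inl ⟨i, hi, rfl⟩))
    · have h1 : v c + v (D.σ c) ∈ U ⊓ F m.castSucc ⊔ W ⊓ F m.castSucc := by
        rw [hW]
        exact Submodule.mem_sup_right (Submodule.subset_span (Or.inr ⟨c, hc, rfl⟩))
      have := sub_mem h1 (hvα c (D.γ_subset_α hc))
      rwa [add_sub_cancel_left] at this
  let y' : V := ∑ i ∈ Sᶜ, v.coord i y • v i
  have hysum : y - y' = ∑ i ∈ S, v.coord i y • v i := by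
    rw [sub_eq_iff_eq_add, Finset.sum_add_sum_compl]
    exact (v.sum_repr y).symm
  have hyy' : y - y' ∈ U ⊓ F m.castSucc ⊔ W ⊓ F m.castSucc := by
    rw [hysum]
    exact Submodule.sum_mem _ fun i hi => Submodule.smul_mem _ _ (hmem i hi)
  have hcoord : ∀ i, v.coord i y' = if i ∈ S then 0 else v.coord i y := by
    intro i
    simp [y', Finsupp.single_apply]
  have hy'0 : y' ≠ 0 := by
    intro h0
    rw [h0, sub_zero] at hyy'
    exact h hyy'
  let T : Finset (Fin n) := Finset.univ.filter fun i => v.coord i y' ≠ 0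
  have hT : T.Nonempty := by
    by_contra hT
    refine hy'0 (v.forall_coord_eq_zero_iff.1 fun i => ?_)
    by_contra hi
    exact hT ⟨i, Finset.mem_filter.2 ⟨Finset.mem_univ _, hi⟩⟩
  -- `d` is the leading index of `y'`. It avoids `S`, hence is unused by the old data, and it is
  -- below `m`, so putting `y'` in place of `v d` keeps the basis adapted.
  let d := T.max' hT
  have hdT : v.coord d y' ≠ 0 := (Finset.mem_filter.1 (T.max'_mem hT)).2
  have hdmax : ∀ i, d < i → v.coord i y' = 0 := by
    intro i hi
    by_contra hne
    exact absurd (T.le_max' i (Finset.mem_filter.2 ⟨Finset.mem_univ _, hne⟩)) hi.not_ge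
  have hdS : d ∉ S := by
    intro hd
    rw [hcoord, if_pos hd] at hdT
    exact hdT rfl
  have hdm : d < m := by
    by_contra hd
    rw [hcoord, if_neg hdS] at hdT
    rw [hv] at huw
    exact hdT ((mem_flag_iff v).1 huw d (Fin.castSucc_le_castSucc_iff.2 (not_lt.1 hd)))
  simp only [S, Finset.mem_union, Finset.mem_image, not_or, not_exists, not_and] at hdS
  obtain ⟨u₁, hu₁, w₁, hw₁, huw₁⟩ := Submodule.mem_sup.1 hyy'
  have hu₂ : u + u₁ ∈ U := add_mem hu hu₁.1
  have hu₂F : u + u₁ ∈ F m.succ := add_mem huF (hF.mono m.castSucc_le_succ hu₁.2)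
  have hu₂F' : u + u₁ ∉ F m.castSucc := fun h' => huF' ((add_mem_cancel_right hu₁.2).1 h')
  have hw₂ : (u + u₁) + y' ∈ W := by
    have : (u + u₁) + y' = w - w₁ := by
      rw [eq_sub_of_add_eq huw₁, hy]
      abel
    rw [this]
    exact sub_mem hw hw₁.1
  have hy'F : y' ∈ F d.succ := by
    rw [hv]
    exact (mem_flag_iff v).2 fun i hi => hdmax i (Fin.succ_le_castSucc_iff.1 hi)
  have hy'F' : y' ∉ F d.castSucc := by
    rw [hv]
    exact fun h' => hdT ((mem_flag_iff v).1 h' d le_rfl)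
  have hy'm : y' ∈ F m.castSucc := hF.mono (Fin.succ_le_castSucc_iff.2 hdm) hy'F
  obtain ⟨b, hb, hbF⟩ := hF.exists_basis_of_adapted
    (v := Function.update (Function.update v d y') m (u + u₁)) (fun i => by
    by_cases h : i = m
    · subst h
      rw [Function.update_self]
      exact ⟨hu₂F, hu₂F'⟩
    · rw [Function.update_of_ne h]
      by_cases h : i = d
      · subst h
        rw [Function.update_self]
        exact ⟨hy'F, hy'F'⟩
      · rw [Function.update_of_ne h]
        exact adapted_of_flag_eq hv i)
  have hbm : b m = u + u₁ := by rw [hb, Function.update_self]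
  have hbd : b d = y' := by rw [hb, Function.update_of_ne hdm.ne, Function.update_self]
  have hbi : ∀ i < m, i ≠ d → b i = v i := fun i hi hid => by
    rw [hb, Function.update_of_ne hi.ne, Function.update_of_ne hid]
  have hlt : ∀ {i}, i < m → i.castSucc < m.succ := fun h =>
    (Fin.castSucc_lt_castSucc_iff.2 h).trans m.castSucc_lt_succ
  let D' := D.insertSwap m d hα' hβ' hdm hdS.1.1 hdS.1.2 hdS.2
  have hσm : D'.σ m = d := by
    change Equiv.swap m d (D.σ m) = d
    rw [D.σ_fix m (fun h => (hα' m (D.γ_subset_α h)).false)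
      fun c hc => ((D.σ_lt c hc).trans (hα' c (D.γ_subset_α hc))).ne, Equiv.swap_apply_left]
  have hbγ : ∀ c ∈ D.γ, b c + b (D'.σ c) = v c + v (D.σ c) := fun c hc => by
    have hc' := hα' c (D.γ_subset_α hc)
    have h1 : D'.σ c = D.σ c := Equiv.swap_apply_of_ne_of_ne
      ((D.σ_lt c hc).trans hc').ne (hdS.2 c hc)
    rw [h1, hbi c hc' fun h => hdS.1.1 (h ▸ D.γ_subset_α hc),
      hbi _ ((D.σ_lt c hc).trans hc') (hdS.2 c hc)]
  refine ⟨D', b, hbF, ?_, fun i hi => hlt (hβ' i hi), ?_, ?_⟩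
  · intro i hi
    rcases Finset.mem_insert.1 hi with rfl | hi
    · exact i.castSucc_lt_succ
    · exact hlt (hα' i hi)
  · change _ = Submodule.span K {x | ∃ a ∈ insert m D.α, x = b a}
    rw [setOf_insert_eq (fun a ha => hbi a (hα' a ha) fun h => hdS.1.1 (h ▸ ha)),
      Submodule.span_insert, hbm, ← hU, hF.inf_succ_eq_sup U hu₂ hu₂F hu₂F']
  · change _ = Submodule.span K ({x | ∃ a ∈ D.β, x = b a} ∪
      {x | ∃ c ∈ insert m D.γ, x = b c + b (D'.σ c)})
    rw [setOf_insert_eq (f := fun c => v c + v (D.σ c)) (f' := fun c => b c + b (D'.σ c)) hbγ,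
      setOf_eq_of_eq (fun a ha => hbi a (hβ' a ha) fun h => hdS.1.2 (h ▸ ha)), Set.union_insert,
      Submodule.span_insert, hσm, hbm, hbd,
      hF.inf_succ_eq_sup W hw₂ (add_mem hu₂F (hF.mono m.castSucc_le_succ hy'm))
        (fun h' => hu₂F' ((add_mem_cancel_right hy'm).1 h')), hW, secondSpan]

theorem exists_isTruncatedDataOf_succ (hF : IsCompleteFlag F) {D : CombData n}
    {m : Fin n} (hD : D.IsTruncatedDataOf F U W m.castSucc) :
    ∃ D' : CombData n, D'.IsTruncatedDataOf F U W m.succ := by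
  by_cases hu : ∃ u ∈ U, u ∈ F m.succ ∧ u ∉ F m.castSucc <;>
  by_cases hw : ∃ w ∈ W, w ∈ F m.succ ∧ w ∉ F m.castSucc
  · obtain ⟨u, huU, hu, hu'⟩ := hu
    obtain ⟨w, hwW, hw, hw'⟩ := hw
    -- The quotient of consecutive flag members is a line, so `w` can be rescaled to agree with `u`
    -- there. If the difference is `u₁ + w₁` with summands in the truncated `U` and `W`, then `u +
    -- u₁ = t • w - w₁` is a common new vector.
    obtain ⟨t, ht⟩ : ∃ t : K, t • w - u ∈ F m.castSucc := by
      rw [hF.succ_eq_sup hw hw'] at hu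
      obtain ⟨_, hx, f, hf, rfl⟩ := Submodule.mem_sup.1 hu
      obtain ⟨t, rfl⟩ := Submodule.mem_span_singleton.1 hx
      exact ⟨t, by simpa using hf⟩
    by_cases h : t • w - u ∈ U ⊓ F m.castSucc ⊔ W ⊓ F m.castSucc
    · obtain ⟨u₁, hu₁, w₁, hw₁, huw₁⟩ := Submodule.mem_sup.1 h
      have hzU : u + u₁ ∈ U := add_mem huU hu₁.1
      have hzF : u + u₁ ∈ F m.succ := add_mem hu (hF.mono m.castSucc_le_succ hu₁.2)
      have hzF' : u + u₁ ∉ F m.castSucc := fun h' => hu' ((add_mem_cancel_right hu₁.2).1 h')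
      have hzW : u + u₁ ∈ W := by
        have : u + u₁ = t • w - w₁ := by
          rw [eq_sub_iff_add_eq, add_assoc, huw₁, add_sub_cancel]
        rw [this]
        exact sub_mem (W.smul_mem t hwW) hw₁.1
      exact exists_isTruncatedDataOf_succ_of_pivot hF hD hzF hzF' True True
        (fun _ => hF.inf_succ_eq_sup U hzU hzF hzF') (fun h => absurd trivial h)
        (fun _ => hF.inf_succ_eq_sup W hzW hzF hzF') (fun h => absurd trivial h)
    · exact exists_isTruncatedDataOf_succ_of_not_mem_sup hF hD huU hu hu' (W.smul_mem t hwW) ht h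
  · obtain ⟨u, huU, hu, hu'⟩ := hu
    exact exists_isTruncatedDataOf_succ_of_pivot hF hD hu hu' True False
      (fun _ => hF.inf_succ_eq_sup U huU hu hu') (fun h => absurd trivial h) False.elim
      (fun _ => hF.inf_succ_eq W hw)
  · obtain ⟨w, hwW, hw, hw'⟩ := hw
    exact exists_isTruncatedDataOf_succ_of_pivot hF hD hw hw' False True False.elim
      (fun _ => hF.inf_succ_eq U hu)
      (fun _ => hF.inf_succ_eq_sup W hwW hw hw') (fun h => absurd trivial h)
  · obtain ⟨x, hx, hx'⟩ := hF.exists_adapted m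
    exact exists_isTruncatedDataOf_succ_of_pivot hF hD hx hx' False False False.elim
      (fun _ => hF.inf_succ_eq U hu) False.elim (fun _ => hF.inf_succ_eq W hw)

theorem exists_isTruncatedDataOf (hF : IsCompleteFlag F) (U W : Submodule K V) (m : Fin (n + 1)) :
    ∃ D : CombData n, D.IsTruncatedDataOf F U W m := by
  induction m using Fin.induction with
  | zero =>
    choose x hx hx' using hF.exists_adapted
    obtain ⟨v, -, hv⟩ := hF.exists_basis_of_adapted fun i => ⟨hx i, hx' i⟩
    have h0 : F 0 = ⊥ := by rw [hv, v.flag_zero]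
    refine ⟨⟨∅, ∅, ∅, 1, by simp, by simp, by simp, by simp, by simp, by simp, by simp⟩,
      v, hv, by simp, by simp, ?_, ?_⟩
    · simp [h0]
    · simp [h0, secondSpan]
  | succ m ih =>
    obtain ⟨D, hD⟩ := ih
    exact exists_isTruncatedDataOf_succ hF hD

theorem exists_isDataOf (hF : IsCompleteFlag F) (U W : Submodule K V) :
    ∃ D : CombData n, D.IsDataOf F U W := by
  obtain ⟨D, v, hv, -, -, hU, hW⟩ := exists_isTruncatedDataOf hF U W (Fin.last n)
  rw [hF.top_eq, inf_top_eq] at hU hW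
  exact ⟨D, v, hv, hU, hW⟩

end CombData

end NormalForm

end

end DoubleGr

theorem corollary4 {K V : Type*} [Field K] [AddCommGroup V] [Module K V] [FiniteDimensional K V]
    (L : Type*) [Field L] [IsAlgClosed L] [Algebra K L]
    {n k l : ℕ} (F : Fin (n + 1) → Submodule K V) (hF : DoubleGr.IsCompleteFlag F)
    (U W : Submodule K V) (hU : Module.finrank K U = k) (hW : Module.finrank K W = l) :
    (∃ D : DoubleGr.CombData n, D.IsDataOf F U W) ∧
    ∀ D : DoubleGr.CombData n, D.IsDataOf F U W →
      DoubleGr.orbitDim L k l F U W =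
        ((D.Y₁.card + D.Y₂.card - D.Ycom.card + D.H.card : ℕ) : WithBot ℕ∞) :=
  ⟨DoubleGr.CombData.exists_isDataOf hF U W, fun _ hD => DoubleGr.orbitDim_eq L hU hW hD⟩
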